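/- Let $N$ be a smooth $2$-manifold without boundary (Hausdorff, second countable; for instance $N=\partial M$ for an oriented $3$-manifold $M$ with boundary), endowed with a Lorentzian metric $g$ of signature $(-,+)$, an orientation represented by a nowhere-vanishing $2$-form $\omega$, and a time-orientation represented by a time-like vector field $\tau$. A null vector $v\neq 0$ in $T_pN$ is called $\nearrow$-pointing if $g(\tau,v)<0$ and $\omega(\tau,v)>0$, $\nwarrow$-pointing if $g(\tau,v)<0$ and $\omega(\tau,v)<0$, $\swarrow$-pointing if $g(\tau,v)>0$ and $\omega(\tau,v)<0$, and $\searrow$-pointing if $g(\tau,v)>0$ and $\omega(\tau,v)>0$. For $a\in\{\nearrow,\nwarrow,\swarrow,\searrow\}$ and $K\subseteq N$ let $J^{a}(K)$ be the union of $K$ and the set of all endpoints of smooth curves $[0,1]\to N$ that start in $K$ and all of whose tangent vectors are $a$-pointing null vectors. Let $\ast$ be the Hodge operator on $1$-forms, normalized by $\alpha\wedge\ast\beta=g^{-1}(\alpha,\beta)\,\mathrm{vol}_g$, and let $\Omega^{\pm}(N)=\{\alpha\in\Omega^1(N):\ast\alpha=\pm\alpha\}$. The self-dual ($+$) and anti-self-dual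 ($-$) boundary conditions are the subcomplexes $$\mathfrak{L}^{\pm}=\big(0\to\Omega^{\pm}(N)\xrightarrow{-\mathrm{d}}\Omega^2(N)\big)\subseteq\Omega^\bullet(N)[1],$$ with $\Omega^{\pm}(N)$ in degree $0$. An $a$-pointed Green's homotopy for $\mathfrak{L}^{\pm}$ is a $(-1)$-cochain $G\in[\mathfrak{L}^{\pm}_{\mathrm c},\mathfrak{L}^{\pm}]^{-1}$ of the internal hom complex (where $\mathfrak{L}^\pm_{\mathrm c}$ denotes compactly supported sections) such that $\partial G$ is the inclusion $\mathfrak{L}^{\pm}_{\mathrm c}\to\mathfrak{L}^{\pm}$ and $\mathrm{supp}(G\alpha)\subseteq J^{a}(\mathrm{supp}\,\alpha)$ for all homogeneous $\alpha\in\mathfrak{L}^{\pm}_{\mathrm c}$. A $+$-chiral (respectively $-$-chiral) flow is a smooth $\mathbb{R}$-action $\Theta:\mathbb{R}\times N\to N$ that is the global flow of a complete smooth vector field which is everywhere $\nearrow$-pointing (respectively $\nwarrow$-pointing) and null. It is proper if the map $(s,p)\mapsto(p,\Theta(s,p))$ is proper. For a proper flow $\Theta$ define $$G^{\uparrow}_{\Theta}=\int_{\mathbb{R}^{\leq0}}\Theta^{\ast},\qquad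 G^{\downarrow}_{\Theta}=-\int_{\mathbb{R}^{\geq0}}\Theta^{\ast},$$ where the integrals denote fiber integration along the projection $\mathbb{R}\times N\to N$ restricted to the indicated parameters (fiber direction in the first slot). (1) Let $\Theta_+$ be a proper $+$-chiral flow on $N$. Then $-G^{\uparrow}_{\Theta_+}$ and $-G^{\downarrow}_{\Theta_+}$ are well-defined $(-1)$-cochains in $[\Omega^\bullet_{\mathrm c}(N)[1],\Omega^\bullet(N)[1]]$; they restrict to $(-1)$-cochains $G^{\nearrow}$ and $G^{\swarrow}$ in $[\mathfrak{L}^{+}_{\mathrm c},\mathfrak{L}^{+}]$, and $G^{\nearrow}$ is a $\nearrow$-pointed and $G^{\swarrow}$ a $\swarrow$-pointed Green's homotopy for $\mathfrak{L}^{+}$. (2) Let $\Theta_-$ be a proper $-$-chiral flow on $N$. Then $-G^{\uparrow}_{\Theta_-}$ and $-G^{\downarrow}_{\Theta_-}$ are well-defined $(-1)$-cochains in $[\Omega^\bullet_{\mathrm c}(N)[1],\Omega^\bullet(N)[1]]$; they restrict to $(-1)$-cochains $G^{\nwarrow}$ and $G^{\searrow}$ in $[\mathfrak{L}^{-}_{\mathrm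 c},\mathfrak{L}^{-}]$, and $G^{\nwarrow}$ is a $\nwarrow$-pointed and $G^{\searrow}$ a $\searrow$-pointed Green's homotopy for $\mathfrak{L}^{-}$. -/

import Mathlib

open Set Manifold Bundle ContDiff Topology MeasureTheory
open CategoryTheory CochainComplex.HomComplex

noncomputable section

universe u

/-! ### Differential forms on a surface -/

section Forms

variable (N : Type u) [TopologicalSpace N] [ChartedSpace (EuclideanSpace ℝ (Fin 2)) N]

/-- A field of alternating `k`-linear forms on the tangent spaces of the surface `N`, without any
regularity. -/
abbrev RawForm (k : ℕ) : Type u :=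
  ∀ p : N, TangentSpace (𝓡 2) p [⋀^Fin k]→L[ℝ] ℝ

variable {N}

/-- The representative of a form in the chart around `c`, that is, its pullback along the inverse
of that chart. -/
def RawForm.chartRep {k : ℕ} (α : RawForm N k) (c : N) (y : EuclideanSpace ℝ (Fin 2)) :
    EuclideanSpace ℝ (Fin 2) [⋀^Fin k]→L[ℝ] ℝ :=
  (α ((extChartAt (𝓡 2) c).symm y)).compContinuousLinearMap
    (mfderiv 𝓘(ℝ, EuclideanSpace ℝ (Fin 2)) (𝓡 2) (extChartAt (𝓡 2) c).symm y)

/-- A form is smooth if all its chart representatives are. -/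
def RawForm.IsSmooth {k : ℕ} (α : RawForm N k) : Prop :=
  ∀ c : N, ContDiffOn ℝ ∞ (α.chartRep c) (extChartAt (𝓡 2) c).target

/-- The exterior derivative, computed at `p` in the chart around `p`. -/
def RawForm.extd {k : ℕ} (α : RawForm N k) : RawForm N (k + 1) := fun p =>
  (extDeriv (α.chartRep p) (extChartAt (𝓡 2) p p)).compContinuousLinearMap
    (mfderiv (𝓡 2) 𝓘(ℝ, EuclideanSpace ℝ (Fin 2)) (extChartAt (𝓡 2) p) p)

/-- The support of a form. -/
def RawForm.supp {k : ℕ} (α : RawForm N k) : Set N := closure {p | α p ≠ 0}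

lemma RawForm.chartRep_add {k : ℕ} (α β : RawForm N k) (c : N) :
    (α + β).chartRep c = α.chartRep c + β.chartRep c := rfl

lemma RawForm.chartRep_smul {k : ℕ} (a : ℝ) (α : RawForm N k) (c : N) :
    (a • α).chartRep c = a • α.chartRep c := rfl

lemma RawForm.chartRep_zero {k : ℕ} (c : N) :
    (0 : RawForm N k).chartRep c = 0 := rfl

lemma RawForm.chartRep_eventuallyEq_zero {k : ℕ} {α : RawForm N k} {c : N}
    {y : EuclideanSpace ℝ (Fin 2)} (hy : y ∈ (extChartAt (𝓡 2) c).target)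
    (h : (extChartAt (𝓡 2) c).symm y ∉ α.supp) : α.chartRep c =ᶠ[𝓝 y] 0 := by
  have hcont : ContinuousAt (extChartAt (𝓡 2) c).symm y := continuousAt_extChartAt_symm'' hy
  have hopen : (α.supp)ᶜ ∈ 𝓝 ((extChartAt (𝓡 2) c).symm y) :=
    isClosed_closure.isOpen_compl.mem_nhds h
  filter_upwards [hcont hopen] with z hz
  have h0 : α ((extChartAt (𝓡 2) c).symm z) = 0 := by
    by_contra hne
    exact hz (subset_closure hne)
  simp only [RawForm.chartRep, h0]
  rfl

/-- The exterior derivative does not enlarge supports. -/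
lemma RawForm.supp_extd_subset {k : ℕ} (α : RawForm N k) : α.extd.supp ⊆ α.supp := by
  refine closure_minimal (fun p hp => ?_) isClosed_closure
  by_contra hnot
  apply hp
  have h1 := RawForm.chartRep_eventuallyEq_zero (α := α) (c := p) (mem_extChartAt_target p)
    (by rwa [extChartAt_to_inv])
  have h2 : extDeriv (α.chartRep p) (extChartAt (𝓡 2) p p) = 0 := by
    rw [h1.extDeriv_eq]
    ext v
    simp [extDeriv, Pi.zero_def, ContinuousAlternatingMap.alternatizeUncurryFin_apply]
  simp only [RawForm.extd, h2]
  rfl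

lemma RawForm.extd_add {k : ℕ} {α β : RawForm N k} (hα : α.IsSmooth) (hβ : β.IsSmooth) :
    (α + β).extd = α.extd + β.extd := by
  funext p
  have h := fun {γ : RawForm N k} (hγ : γ.IsSmooth) => ((hγ p).contDiffAt
    ((isOpen_extChartAt_target p).mem_nhds (mem_extChartAt_target p))).differentiableAt (by simp)
  simp only [RawForm.extd, RawForm.chartRep_add, extDeriv_add (h hα) (h hβ), Pi.add_apply]
  rfl

lemma RawForm.extd_smul {k : ℕ} (a : ℝ) (α : RawForm N k) :
    (a • α).extd = a • α.extd := by
  funext p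
  simp only [RawForm.extd, RawForm.chartRep_smul, extDeriv_smul, Pi.smul_apply]
  rfl

/-- The covector underlying a `1`-form at a point. -/
def covector {p : N} (α : TangentSpace (𝓡 2) p [⋀^Fin 1]→L[ℝ] ℝ) : TangentSpace (𝓡 2) p →L[ℝ] ℝ :=
  α.toContinuousMultilinearMap.toContinuousLinearMap 0 0

lemma covector_add {p : N} (α β : TangentSpace (𝓡 2) p [⋀^Fin 1]→L[ℝ] ℝ) :
    covector (α + β) = covector α + covector β := rfl

lemma covector_smul {p : N} (a : ℝ) (α : TangentSpace (𝓡 2) p [⋀^Fin 1]→L[ℝ] ℝ) :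
    covector (a • α) = a • covector α := rfl

lemma covector_zero {p : N} :
    covector (0 : TangentSpace (𝓡 2) p [⋀^Fin 1]→L[ℝ] ℝ) = 0 := rfl

variable [IsManifold (𝓡 2) ∞ N]

/-- A form is recovered from its representative in any chart. -/
lemma RawForm.chartRep_comp_mfderiv {k : ℕ} (α : RawForm N k) (c : N) {x : N}
    (hx : x ∈ (extChartAt (𝓡 2) c).source) :
    (α.chartRep c (extChartAt (𝓡 2) c x)).compContinuousLinearMap
      (mfderiv (𝓡 2) 𝓘(ℝ, EuclideanSpace ℝ (Fin 2)) (extChartAt (𝓡 2) c) x) = α x := by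
  have hinv : (mfderiv 𝓘(ℝ, EuclideanSpace ℝ (Fin 2)) (𝓡 2) (extChartAt (𝓡 2) c).symm
        (extChartAt (𝓡 2) c x)).comp
      (mfderiv (𝓡 2) 𝓘(ℝ, EuclideanSpace ℝ (Fin 2)) (extChartAt (𝓡 2) c) x) =
      ContinuousLinearMap.id ℝ _ := by
    have := mfderivWithin_extChartAt_symm_comp_mfderiv_extChartAt' (I := 𝓡 2) hx
    simpa [mfderivWithin_univ] using this
  have hpt : ∀ (x' : N) (_ : x' = x) (w : Fin k → EuclideanSpace ℝ (Fin 2)),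
      (α x' : EuclideanSpace ℝ (Fin 2) [⋀^Fin k]→L[ℝ] ℝ) w =
        (α x : EuclideanSpace ℝ (Fin 2) [⋀^Fin k]→L[ℝ] ℝ) w := by
    rintro x' rfl w; rfl
  ext v
  refine (hpt _ ((extChartAt (𝓡 2) c).left_inv hx) _).trans ?_
  refine congrArg (α x : EuclideanSpace ℝ (Fin 2) [⋀^Fin k]→L[ℝ] ℝ) ?_
  funext i
  exact DFunLike.congr_fun hinv (v i)

lemma mfderiv_extChartAt_comp_symm (c c' : N) {y : EuclideanSpace ℝ (Fin 2)}
    (hy : y ∈ ((extChartAt (𝓡 2) c).symm ≫ extChartAt (𝓡 2) c').source) :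
    fderiv ℝ (extChartAt (𝓡 2) c' ∘ (extChartAt (𝓡 2) c).symm) y =
      (mfderiv (𝓡 2) 𝓘(ℝ, EuclideanSpace ℝ (Fin 2)) (extChartAt (𝓡 2) c')
        ((extChartAt (𝓡 2) c).symm y)).comp
        (mfderiv 𝓘(ℝ, EuclideanSpace ℝ (Fin 2)) (𝓡 2) (extChartAt (𝓡 2) c).symm y) := by
  rw [PartialEquiv.trans_source] at hy
  have hcs : MDifferentiableAt 𝓘(ℝ, EuclideanSpace ℝ (Fin 2)) (𝓡 2)
      (extChartAt (𝓡 2) c).symm y :=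
    ((contMDiffOn_extChartAt_symm (n := ∞) c).contMDiffAt
      ((isOpen_extChartAt_target c).mem_nhds hy.1)).mdifferentiableAt (by simp)
  have hc' : MDifferentiableAt (𝓡 2) 𝓘(ℝ, EuclideanSpace ℝ (Fin 2))
      (extChartAt (𝓡 2) c') ((extChartAt (𝓡 2) c).symm y) :=
    (contMDiffAt_extChartAt' (n := ∞) (by
      have := hy.2
      rwa [mem_preimage, extChartAt_source] at this)).mdifferentiableAt (by simp)
  rw [← mfderiv_eq_fderiv]
  exact mfderiv_comp y hc' hcs

/-- Change of charts for chart representatives. -/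
lemma RawForm.chartRep_change {k : ℕ} (α : RawForm N k) (c c' : N)
    {y : EuclideanSpace ℝ (Fin 2)}
    (hy : y ∈ ((extChartAt (𝓡 2) c).symm ≫ extChartAt (𝓡 2) c').source) :
    α.chartRep c y =
      (α.chartRep c' ((extChartAt (𝓡 2) c' ∘ (extChartAt (𝓡 2) c).symm) y)).compContinuousLinearMap
        (fderiv ℝ (extChartAt (𝓡 2) c' ∘ (extChartAt (𝓡 2) c).symm) y) := by
  rw [mfderiv_extChartAt_comp_symm c c' hy]
  rw [PartialEquiv.trans_source] at hy
  have h := RawForm.chartRep_comp_mfderiv α c' hy.2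
  rw [RawForm.chartRep, ← h]
  rfl

/-- In every chart, `RawForm.extd` is the exterior derivative of the chart representative. -/
lemma RawForm.chartRep_extd {k : ℕ} {α : RawForm N k} (hα : α.IsSmooth) (c : N)
    {y : EuclideanSpace ℝ (Fin 2)} (hy : y ∈ (extChartAt (𝓡 2) c).target) :
    α.extd.chartRep c y = extDeriv (α.chartRep c) y := by
  set x := (extChartAt (𝓡 2) c).symm y with hx
  have hyx : y ∈ ((extChartAt (𝓡 2) c).symm ≫ extChartAt (𝓡 2) x).source := by
    rw [PartialEquiv.trans_source]
    exact ⟨hy, mem_extChartAt_source x⟩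
  have hopen : IsOpen ((extChartAt (𝓡 2) c).symm ≫ extChartAt (𝓡 2) x).source := by
    rw [PartialEquiv.trans_source]
    exact (continuousOn_extChartAt_symm c).isOpen_inter_preimage
      (isOpen_extChartAt_target c) (isOpen_extChartAt_source x)
  have hf : ContDiffAt ℝ ∞ (extChartAt (𝓡 2) x ∘ (extChartAt (𝓡 2) c).symm) y :=
    (contDiffOn_ext_coord_change (n := ∞) x c).contDiffAt (hopen.mem_nhds hyx)
  have hfy : (extChartAt (𝓡 2) x ∘ (extChartAt (𝓡 2) c).symm) y = extChartAt (𝓡 2) x x := rfl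
  have hdiff : DifferentiableAt ℝ (α.chartRep x)
      ((extChartAt (𝓡 2) x ∘ (extChartAt (𝓡 2) c).symm) y) := by
    rw [hfy]
    exact ((hα x).contDiffAt ((isOpen_extChartAt_target x).mem_nhds
      (mem_extChartAt_target x))).differentiableAt (by simp)
  have heq : α.chartRep c =ᶠ[𝓝 y] fun z =>
      (α.chartRep x ((extChartAt (𝓡 2) x ∘ (extChartAt (𝓡 2) c).symm) z)).compContinuousLinearMap
        (fderiv ℝ (extChartAt (𝓡 2) x ∘ (extChartAt (𝓡 2) c).symm) z) := by
    filter_upwards [hopen.mem_nhds hyx] with z hz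
    exact RawForm.chartRep_change α c x hz
  rw [heq.extDeriv_eq, extDeriv_pullback hdiff hf (by simp; exact WithTop.coe_le_coe.2 le_top),
    mfderiv_extChartAt_comp_symm c x hyx]
  rfl

lemma RawForm.IsSmooth.extd {k : ℕ} {α : RawForm N k} (hα : α.IsSmooth) :
    α.extd.IsSmooth := by
  intro c
  have h1 : ContDiffOn ℝ ∞ (extDeriv (α.chartRep c)) (extChartAt (𝓡 2) c).target :=
    (ContinuousAlternatingMap.alternatizeUncurryFinCLM ℝ (EuclideanSpace ℝ (Fin 2)) ℝ).contDiff.comp_contDiffOn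
      ((hα c).fderiv_of_isOpen (isOpen_extChartAt_target c) (by simp))
  exact h1.congr fun y hy => RawForm.chartRep_extd hα c hy

lemma RawForm.extd_extd {k : ℕ} {α : RawForm N k} (hα : α.IsSmooth) : α.extd.extd = 0 := by
  funext p
  have hp := mem_extChartAt_target (I := 𝓡 2) p
  have hev : α.extd.chartRep p =ᶠ[𝓝 (extChartAt (𝓡 2) p p)] extDeriv (α.chartRep p) := by
    filter_upwards [(isOpen_extChartAt_target p).mem_nhds hp] with y hy
    exact RawForm.chartRep_extd hα p hy
  have h0 : extDeriv (α.extd.chartRep p) (extChartAt (𝓡 2) p p) = 0 := by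
    rw [hev.extDeriv_eq]
    exact extDeriv_extDeriv_apply
      ((hα p).contDiffAt ((isOpen_extChartAt_target p).mem_nhds hp)) (by simp; exact WithTop.coe_le_coe.2 le_top)
  simp only [RawForm.extd, h0]
  rfl

end Forms

/-! ### Complexes of differential forms -/

section Complexes

variable (N : Type u) [TopologicalSpace N] [ChartedSpace (EuclideanSpace ℝ (Fin 2)) N]

/-- A subcomplex of the de Rham complex of `N`: in every form degree a linear space of smooth forms,
stable under the exterior derivative. -/
structure DeRhamSubcomplex where
  carrier : ∀ k : ℕ, Submodule ℝ (RawForm N k)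
  smooth : ∀ {k : ℕ} {α : RawForm N k}, α ∈ carrier k → α.IsSmooth
  extd_mem : ∀ {k : ℕ} {α : RawForm N k}, α ∈ carrier k → α.extd ∈ carrier (k + 1)

/-- The space of smooth `k`-forms. -/
def smoothForms (k : ℕ) : Submodule ℝ (RawForm N k) where
  carrier := {α | α.IsSmooth}
  add_mem' := fun hα hβ c => by
    rw [RawForm.chartRep_add]
    exact (hα c).add (hβ c)
  zero_mem' := fun c => by
    rw [RawForm.chartRep_zero]
    exact contDiffOn_const
  smul_mem' := fun a α hα c => by
    rw [RawForm.chartRep_smul]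
    exact contDiffOn_const.smul (hα c)

/-- The space of `k`-forms with compact support. -/
def compactlySupportedForms (k : ℕ) : Submodule ℝ (RawForm N k) where
  carrier := {α | IsCompact α.supp}
  add_mem' := fun {α β} hα hβ => by
    refine (IsCompact.union hα hβ).of_isClosed_subset isClosed_closure ?_
    unfold RawForm.supp
    rw [← closure_union]
    refine closure_mono fun p hp => ?_
    by_contra h
    simp only [mem_union, mem_ofPred_eq, not_or, not_not] at h
    exact hp (by rw [Pi.add_apply, h.1, h.2, add_zero])
  zero_mem' := by simp [RawForm.supp]
  smul_mem' := fun a α hα => by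
    refine IsCompact.of_isClosed_subset hα isClosed_closure (closure_mono fun p hp h => ?_)
    exact hp (by rw [Pi.smul_apply, h, smul_zero])

variable {N}

/-- The subcomplex of compactly supported forms in a subcomplex. -/
def DeRhamSubcomplex.compact (A : DeRhamSubcomplex N) : DeRhamSubcomplex N where
  carrier k := A.carrier k ⊓ compactlySupportedForms N k
  smooth hα := A.smooth hα.1
  extd_mem hα := ⟨A.extd_mem hα.1,
    IsCompact.of_isClosed_subset hα.2 isClosed_closure (RawForm.supp_extd_subset _)⟩

/-- The exterior derivative as a linear map on a subcomplex. -/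
def DeRhamSubcomplex.d (A : DeRhamSubcomplex N) (k : ℕ) : A.carrier k →ₗ[ℝ] A.carrier (k + 1) where
  toFun α := ⟨α.1.extd, A.extd_mem α.2⟩
  map_add' α β := Subtype.ext (RawForm.extd_add (A.smooth α.2) (A.smooth β.2))
  map_smul' a α := Subtype.ext (RawForm.extd_smul a α.1)

/-- The degree `n` part, `n` an integer, of a subcomplex of the de Rham complex. A member is a
`k`-form for the natural number `k = n`; if `n` is negative, the space is trivial. -/
abbrev DeRhamSubcomplex.degree (A : DeRhamSubcomplex N) (n : ℤ) : Type u :=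
  ∀ k : {k : ℕ // (k : ℤ) = n}, A.carrier k

/-- The exterior derivative on the integer-graded subcomplex. -/
def DeRhamSubcomplex.dInt (A : DeRhamSubcomplex N) (n : ℤ) :
    A.degree n →ₗ[ℝ] A.degree (n + 1) where
  toFun x
    | ⟨0, _⟩ => 0
    | ⟨k + 1, h⟩ => A.d k (x ⟨k, by push_cast at h; lia⟩)
  map_add' x y := by
    funext ⟨k, h⟩
    cases k with
    | zero => exact (add_zero 0).symm
    | succ k => exact map_add (A.d k) _ _
  map_smul' a x := by
    funext ⟨k, h⟩
    cases k with
    | zero => exact (smul_zero a).symm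
    | succ k => exact map_smul (A.d k) a _

variable [IsManifold (𝓡 2) ∞ N]

variable (N) in
/-- The de Rham complex of `N`. -/
def deRham : DeRhamSubcomplex N where
  carrier := smoothForms N
  smooth hα := hα
  extd_mem hα := RawForm.IsSmooth.extd hα

/-- A subcomplex of the de Rham complex as a cochain complex, graded by form degree. -/
def DeRhamSubcomplex.toComplex (A : DeRhamSubcomplex N) : CochainComplex (ModuleCat.{u} ℝ) ℤ :=
  CochainComplex.of (fun n => ModuleCat.of ℝ (A.degree n)) (fun n => ModuleCat.ofHom (A.dInt n))
    (fun n => by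
      refine ModuleCat.hom_ext (LinearMap.ext fun x => funext fun k => ?_)
      match k with
      | ⟨0, _⟩ => rfl
      | ⟨1, _⟩ => exact map_zero (A.d 0)
      | ⟨k + 2, _⟩ => exact Subtype.ext (RawForm.extd_extd (A.smooth (Subtype.property _))))

/-- The `1`-shifted complex `A[1]`: it has the `k`-forms in degree `k - 1`, and differential `-d`. -/
abbrev DeRhamSubcomplex.shifted (A : DeRhamSubcomplex N) : CochainComplex (ModuleCat.{u} ℝ) ℤ :=
  A.toComplex⟦(1 : ℤ)⟧

/-- The `k`-form underlying an element of `A[1]` of degree `p = k - 1`. -/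
def DeRhamSubcomplex.form (A : DeRhamSubcomplex N) {p : ℤ} (x : A.shifted.X p) (k : ℕ)
    (hk : (k : ℤ) = p + 1) : RawForm N k :=
  ((show A.degree (p + 1) from x) ⟨k, hk⟩).1

/-- The support of a homogeneous element of `A[1]`. -/
def DeRhamSubcomplex.supp (A : DeRhamSubcomplex N) {p : ℤ} (x : A.shifted.X p) : Set N :=
  closure {q | ∃ (k : ℕ) (hk : (k : ℤ) = p + 1), A.form x k hk q ≠ 0}

/-- The inclusion of a subcomplex in a larger one, as a cochain map. -/
def DeRhamSubcomplex.incl {A B : DeRhamSubcomplex N} (h : ∀ k, A.carrier k ≤ B.carrier k) :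
    A.toComplex ⟶ B.toComplex :=
  CochainComplex.ofHom
    (fun n => ModuleCat.ofHom
      (LinearMap.pi fun k => (Submodule.inclusion (h k)).comp (LinearMap.proj k)))
    (fun n => by
      simp only [DeRhamSubcomplex.toComplex, CochainComplex.of_d]
      refine ModuleCat.hom_ext (LinearMap.ext fun x => funext fun k => ?_)
      match k with
      | ⟨0, _⟩ => rfl
      | ⟨k + 1, _⟩ => rfl)

/-- A Green's homotopy for `A[1]` whose supports are controlled by `J`: a `(-1)`-cochain in the
internal hom complex from the compactly supported part of `A[1]` to `A[1]` whose differential is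
the canonical inclusion. -/
structure IsGreensHomotopy (A : DeRhamSubcomplex N) (J : Set N → Set N)
    (G : Cochain A.compact.shifted A.shifted (-1)) : Prop where
  boundary : δ (-1) 0 G =
    Cochain.ofHom ((DeRhamSubcomplex.incl (A := A.compact) (B := A)
      fun _ => inf_le_left)⟦(1 : ℤ)⟧')
  supp_subset : ∀ (p q : ℤ) (h : p + -1 = q) (x : A.compact.shifted.X p),
    A.supp ((G.v p q h).hom x) ⊆ J (A.compact.supp x)

end Complexes

/-! ### Flows and fiber integration -/

section Flows

variable {N : Type u} [TopologicalSpace N] [ChartedSpace (EuclideanSpace ℝ (Fin 2)) N]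

/-- A (global, smooth) flow on `N`, that is, a smooth action of `ℝ` on `N`. -/
structure IsFlow (Θ : ℝ × N → N) : Prop where
  contMDiff : ContMDiff (𝓘(ℝ, ℝ).prod (𝓡 2)) (𝓡 2) ∞ Θ
  zero : ∀ p, Θ (0, p) = p
  add : ∀ s t p, Θ (s + t, p) = Θ (s, Θ (t, p))

/-- A flow is proper if its shear map `(s, p) ↦ (p, Θ (s, p))` is proper. -/
def IsProperFlow (Θ : ℝ × N → N) : Prop :=
  IsProperMap fun x : ℝ × N => (x.2, Θ x)

/-- The pullback of a form along `Θ : ℝ × N → N`. -/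
def flowPullback (Θ : ℝ × N → N) {k : ℕ} (α : RawForm N k) (x : ℝ × N) :
    TangentSpace (𝓘(ℝ, ℝ).prod (𝓡 2)) x [⋀^Fin k]→L[ℝ] ℝ :=
  (α (Θ x)).compContinuousLinearMap (mfderiv (𝓘(ℝ, ℝ).prod (𝓡 2)) (𝓡 2) Θ x)

/-- The fiber integral, evaluated at the vectors `v i` tangent to `N` at `p`, of the pullback of a
form along `Θ` restricted to `T × N`, along the projection `T × N → N`, where `T` is an interval.
The fiber direction is inserted in the first slot. -/
def fiberIntegral (T : Set ℝ) (Θ : ℝ × N → N) {k : ℕ} (α : RawForm N (k + 1)) (p : N)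
    (v : Fin k → TangentSpace (𝓡 2) p) : ℝ :=
  ∫ s in T, flowPullback Θ α (s, p)
    (Fin.cons (show TangentSpace (𝓘(ℝ, ℝ).prod (𝓡 2)) (s, p) from ((1 : ℝ), 0))
      fun i => (show TangentSpace (𝓘(ℝ, ℝ).prod (𝓡 2)) (s, p) from ((0 : ℝ), v i)))

/-- The forward operator `α ↦ ∫_{s ≤ 0} Θ^* α`. -/
def forwardG (Θ : ℝ × N → N) {k : ℕ} (α : RawForm N (k + 1)) (p : N)
    (v : Fin k → TangentSpace (𝓡 2) p) : ℝ :=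
  fiberIntegral (Iic 0) Θ α p v

/-- The backward operator `α ↦ - ∫_{s ≥ 0} Θ^* α`. -/
def backwardG (Θ : ℝ × N → N) {k : ℕ} (α : RawForm N (k + 1)) (p : N)
    (v : Fin k → TangentSpace (𝓡 2) p) : ℝ :=
  -fiberIntegral (Ici 0) Θ α p v

end Flows

/-! ### Oriented and time-oriented Lorentzian surfaces -/

section Lorentz

/-- The four directions `↗`, `↖`, `↙`, `↘` of null vectors on a surface. -/
inductive NullDirection
  | ne
  | nw
  | sw
  | se

variable (N : Type u) [TopologicalSpace N] [ChartedSpace (EuclideanSpace ℝ (Fin 2)) N]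
  [IsManifold (𝓡 2) ∞ N]

/-- A Lorentzian metric of signature `(-,+)` on the surface `N`, an orientation, represented by
a nowhere vanishing `2`-form, and a time orientation, represented by a time-like vector field. -/
structure LorentzStructure where
  g : ∀ p : N, TangentSpace (𝓡 2) p →L[ℝ] TangentSpace (𝓡 2) p →L[ℝ] ℝ
  g_smooth : ContMDiff (𝓡 2) ((𝓡 2).prod 𝓘(ℝ, EuclideanSpace ℝ (Fin 2) →L[ℝ]
      EuclideanSpace ℝ (Fin 2) →L[ℝ] ℝ)) ∞
    (fun p => TotalSpace.mk' (EuclideanSpace ℝ (Fin 2) →L[ℝ] EuclideanSpace ℝ (Fin 2) →L[ℝ] ℝ)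
      (E := fun p : N => TangentSpace (𝓡 2) p →L[ℝ] TangentSpace (𝓡 2) p →L[ℝ] ℝ) p (g p))
  g_symm : ∀ p u v, g p u v = g p v u
  g_signature : ∀ p, ∃ e : Fin 2 → TangentSpace (𝓡 2) p,
    g p (e 0) (e 0) = -1 ∧ g p (e 1) (e 1) = 1 ∧ g p (e 0) (e 1) = 0
  orient : RawForm N 2
  orient_smooth : orient.IsSmooth
  orient_ne_zero : ∀ p, orient p ≠ 0
  time : ∀ p : N, TangentSpace (𝓡 2) p
  time_smooth : ContMDiff (𝓡 2) (𝓡 2).tangent ∞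
    (fun p => (⟨p, time p⟩ : TangentBundle (𝓡 2) N))
  time_timelike : ∀ p, g p (time p) (time p) < 0

variable {N}

namespace LorentzStructure

variable (S : LorentzStructure N)

/-- A chosen orthonormal frame at `p`, with no condition on its orientation. -/
def frame (p : N) : Fin 2 → TangentSpace (𝓡 2) p := (S.g_signature p).choose

/-- The volume form of the metric and the orientation: the positive multiple of the orienting form
that takes the values `1` and `-1` on orthonormal frames. -/
def vol (p : N) : TangentSpace (𝓡 2) p [⋀^Fin 2]→L[ℝ] ℝ :=
  |S.orient p (S.frame p)|⁻¹ • S.orient p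

lemma g_injective (p : N) : Function.Injective (S.g p) := by
  obtain ⟨e, h00, h11, h01⟩ := S.g_signature p
  have h10 : S.g p (e 1) (e 0) = 0 := by rw [S.g_symm, h01]
  have hli : LinearIndependent ℝ e := by
    rw [Fintype.linearIndependent_iff]
    intro c hc
    rw [Fin.sum_univ_two] at hc
    have k0 : S.g p (c 0 • e 0 + c 1 • e 1) (e 0) = 0 := by rw [hc, map_zero]; rfl
    have k1 : S.g p (c 0 • e 0 + c 1 • e 1) (e 1) = 0 := by rw [hc, map_zero]; rfl
    simp [h00, h10] at k0
    simp [h11, h01] at k1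
    intro i
    fin_cases i <;> assumption
  have hfr : Fintype.card (Fin 2) = Module.finrank ℝ (TangentSpace (𝓡 2) p) := by
    change _ = Module.finrank ℝ (EuclideanSpace ℝ (Fin 2))
    simp
  let b := basisOfLinearIndependentOfCardEqFinrank hli hfr
  rw [injective_iff_map_eq_zero]
  intro u hu
  have hb : ∀ i, b i = e i := fun i => by simp [b]
  have hsum := b.sum_repr u
  rw [Fin.sum_univ_two, hb, hb] at hsum
  have h0 : S.g p u (e 0) = 0 := by rw [hu]; rfl
  have h1 : S.g p u (e 1) = 0 := by rw [hu]; rfl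
  rw [← hsum] at h0 h1
  simp [h00, h10] at h0
  simp [h11, h01] at h1
  rw [← hsum, h0, h1]
  simp

lemma g_bijective (p : N) : Function.Bijective (S.g p).toLinearMap := by
  have : FiniteDimensional ℝ (TangentSpace (𝓡 2) p) :=
    inferInstanceAs (FiniteDimensional ℝ (EuclideanSpace ℝ (Fin 2)))
  have : T2Space (TangentSpace (𝓡 2) p) := inferInstanceAs (T2Space (EuclideanSpace ℝ (Fin 2)))
  have hfr : Module.finrank ℝ (TangentSpace (𝓡 2) p) =
      Module.finrank ℝ (TangentSpace (𝓡 2) p →L[ℝ] ℝ) := by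
    rw [← (LinearMap.toContinuousLinearMap (𝕜 := ℝ) (E := TangentSpace (𝓡 2) p)
      (F' := ℝ)).finrank_eq]
    exact (Subspace.dual_finrank_eq (K := ℝ) (V := TangentSpace (𝓡 2) p)).symm
  have : FiniteDimensional ℝ (TangentSpace (𝓡 2) p →L[ℝ] ℝ) :=
    Module.Finite.equiv (LinearMap.toContinuousLinearMap (𝕜 := ℝ) (E := TangentSpace (𝓡 2) p)
      (F' := ℝ))
  exact ⟨S.g_injective p,
    (LinearMap.injective_iff_surjective_of_finrank_eq_finrank hfr).1 (S.g_injective p)⟩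

/-- The musical isomorphism `v ↦ g (v, ·)`. -/
def flat (p : N) :
    TangentSpace (𝓡 2) p ≃ₗ[ℝ] (TangentSpace (𝓡 2) p →L[ℝ] ℝ) :=
  LinearEquiv.ofBijective (S.g p).toLinearMap (S.g_bijective p)

/-- The Hodge operator on covectors: `* β` is the contraction of the volume form with the vector
dual to `β`, so that `α ∧ * β = g⁻¹ (α, β) vol`. -/
def hodgeStar (p : N) (β : TangentSpace (𝓡 2) p →L[ℝ] ℝ) : TangentSpace (𝓡 2) p →L[ℝ] ℝ :=
  (S.vol p).toContinuousMultilinearMap.toContinuousLinearMap ![(S.flat p).symm β, 0] 1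

lemma hodgeStar_apply (p : N) (β : TangentSpace (𝓡 2) p →L[ℝ] ℝ) (v : TangentSpace (𝓡 2) p) :
    S.hodgeStar p β v = S.vol p ![(S.flat p).symm β, v] := by
  change S.vol p (Function.update ![(S.flat p).symm β, 0] 1 v) = _
  congr 1
  ext i : 1
  fin_cases i <;> rfl

lemma hodgeStar_add (p : N) (β γ : TangentSpace (𝓡 2) p →L[ℝ] ℝ) :
    S.hodgeStar p (β + γ) = S.hodgeStar p β + S.hodgeStar p γ := by
  ext v
  simp only [_root_.add_apply, hodgeStar_apply, map_add]
  exact (S.vol p).toMultilinearMap.cons_add ![v] _ _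

lemma hodgeStar_smul (p : N) (a : ℝ) (β : TangentSpace (𝓡 2) p →L[ℝ] ℝ) :
    S.hodgeStar p (a • β) = a • S.hodgeStar p β := by
  ext v
  simp only [_root_.smul_apply, hodgeStar_apply, map_smul]
  exact (S.vol p).toMultilinearMap.cons_smul ![v] _ _

/-- The smooth `1`-forms `α` with `* α = ε α`: the self-dual forms for `ε = 1` and the
anti-self-dual forms for `ε = -1`. -/
def dualForms (ε : ℝ) : Submodule ℝ (RawForm N 1) where
  carrier := {α | α.IsSmooth ∧ ∀ p, S.hodgeStar p (covector (α p)) = ε • covector (α p)}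
  add_mem' := fun {α β} hα hβ => ⟨(smoothForms N 1).add_mem hα.1 hβ.1, fun p => by
    rw [Pi.add_apply, covector_add, hodgeStar_add, hα.2, hβ.2, smul_add]⟩
  zero_mem' := ⟨(smoothForms N 1).zero_mem, fun p => by
    have := S.hodgeStar_smul p 0 0
    rw [zero_smul, zero_smul] at this
    rw [Pi.zero_apply, covector_zero, this, smul_zero]⟩
  smul_mem' := fun a α hα => ⟨(smoothForms N 1).smul_mem a hα.1, fun p => by
    rw [Pi.smul_apply, covector_smul, hodgeStar_smul, hα.2, smul_comm]⟩

/-- The subcomplex `0 → {α ∈ Ω¹ | * α = ε α} → Ω²` of the de Rham complex. (Forms of degree larger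
than two vanish on a surface.) -/
def dualComplex (ε : ℝ) : DeRhamSubcomplex N where
  carrier
    | 0 => ⊥
    | 1 => S.dualForms ε
    | k + 2 => smoothForms N (k + 2)
  smooth {k α} hα := by
    match k, α, hα with
    | 0, α, hα =>
      rw [(Submodule.mem_bot ℝ).1 hα]
      exact (smoothForms N 0).zero_mem
    | 1, α, hα => exact hα.1
    | k + 2, α, hα => exact hα
  extd_mem {k α} hα := by
    match k, α, hα with
    | 0, α, hα =>
      have h := RawForm.extd_smul 0 (0 : RawForm N 0)
      rw [zero_smul, zero_smul] at h
      rw [(Submodule.mem_bot ℝ).1 hα, h]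
      exact (S.dualForms ε).zero_mem
    | 1, α, hα => exact RawForm.IsSmooth.extd hα.1
    | k + 2, α, hα => exact RawForm.IsSmooth.extd hα

/-- The self-dual boundary condition `𝔏⁺`; the complex itself is `S.selfDual.shifted`. -/
def selfDual : DeRhamSubcomplex N := S.dualComplex 1

/-- The anti-self-dual boundary condition `𝔏⁻`; the complex itself is `S.antiSelfDual.shifted`. -/
def antiSelfDual : DeRhamSubcomplex N := S.dualComplex (-1)

/-- A non-zero null vector pointing in one of the four directions. -/
def IsPointing (dir : NullDirection) (p : N) (v : TangentSpace (𝓡 2) p) : Prop :=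
  v ≠ 0 ∧ S.g p v v = 0 ∧
    match dir with
    | .ne => S.g p (S.time p) v < 0 ∧ 0 < S.orient p ![S.time p, v]
    | .nw => S.g p (S.time p) v < 0 ∧ S.orient p ![S.time p, v] < 0
    | .sw => 0 < S.g p (S.time p) v ∧ S.orient p ![S.time p, v] < 0
    | .se => 0 < S.g p (S.time p) v ∧ 0 < S.orient p ![S.time p, v]

/-- A smooth curve `[0,1] → N` all of whose tangent vectors are null vectors pointing in the given
direction. -/
def IsPointingCurve (dir : NullDirection) (γ : ℝ → N) : Prop :=
  ContMDiffOn 𝓘(ℝ, ℝ) (𝓡 2) ∞ γ (Icc 0 1) ∧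
    ∀ t ∈ Icc (0 : ℝ) 1, S.IsPointing dir (γ t)
      (mfderivWithin 𝓘(ℝ, ℝ) (𝓡 2) γ (Icc 0 1) t
        (show TangentSpace 𝓘(ℝ, ℝ) t from (1 : ℝ)))

/-- The set of all points of `K` and all endpoints of curves that start in `K` and point in the
given direction. -/
def J (dir : NullDirection) (K : Set N) : Set N :=
  {q | ∃ p ∈ K, q = p ∨ ∃ γ : ℝ → N, S.IsPointingCurve dir γ ∧ γ 0 = p ∧ γ 1 = q}

/-- The flow of a complete smooth vector field that points in the direction `dir` everywhere:
a `+`-chiral flow for `dir = ↗` and a `-`-chiral flow for `dir = ↖`. -/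
def IsChiralFlow (dir : NullDirection) (Θ : ℝ × N → N) : Prop :=
  IsFlow Θ ∧ ∃ n : ∀ p : N, TangentSpace (𝓡 2) p,
    ContMDiff (𝓡 2) (𝓡 2).tangent ∞ (fun p => (⟨p, n p⟩ : TangentBundle (𝓡 2) N)) ∧
    (∀ p, S.IsPointing dir p (n p)) ∧
    ∀ p, IsMIntegralCurve (fun s => Θ (s, p)) n

end LorentzStructure

end Lorentz

/-! ### Restricting cochains from the de Rham complex -/

section Restriction

variable {N : Type u} [TopologicalSpace N] [ChartedSpace (EuclideanSpace ℝ (Fin 2)) N]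
  [IsManifold (𝓡 2) ∞ N]

/-- The cochain `Γ` on the shifted de Rham complex is `-P`, for an operator `P` that lowers the form
degree by one. -/
def IsNegOf
    (P : ∀ {k : ℕ}, RawForm N (k + 1) → ∀ r : N, (Fin k → TangentSpace (𝓡 2) r) → ℝ)
    (Γ : Cochain (deRham N).compact.shifted (deRham N).shifted (-1)) : Prop :=
  ∀ (p q : ℤ) (h : p + -1 = q) (x : (deRham N).compact.shifted.X p) (k : ℕ)
    (hk : (k : ℤ) = q + 1) (hk' : ((k + 1 : ℕ) : ℤ) = p + 1) (r : N)
    (v : Fin k → TangentSpace (𝓡 2) r),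
    (deRham N).form ((Γ.v p q h).hom x) k hk r v =
      -P ((deRham N).compact.form x (k + 1) hk') r v

/-- The cochain `G` is the restriction to the subcomplex `A[1]` of the cochain `Γ` on the shifted
de Rham complex. -/
def IsRestriction (A : DeRhamSubcomplex N)
    (Γ : Cochain (deRham N).compact.shifted (deRham N).shifted (-1))
    (G : Cochain A.compact.shifted A.shifted (-1)) : Prop :=
  G.comp (Cochain.ofHom ((DeRhamSubcomplex.incl (A := A) (B := deRham N)
      fun _ _ h => A.smooth h)⟦(1 : ℤ)⟧')) (add_zero _) =
    (Cochain.ofHom ((DeRhamSubcomplex.incl (A := A.compact) (B := (deRham N).compact)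
      fun _ _ h => ⟨A.smooth h.1, h.2⟩)⟦(1 : ℤ)⟧')).comp Γ (zero_add _)

end Restriction

end

/-!
On a smooth form `α` of compact support, `α ↦ ∫_{s ≤ 0} Θ^* α` satisfies
`d ∫_{s ≤ 0} Θ^* α + ∫_{s ≤ 0} Θ^* dα = α`: by Cartan's formula for `∂/∂s` this is the fundamental
theorem of calculus in `s`, and the boundary term at `-∞` vanishes because `Θ` is proper. A `1`-form
is self-dual or anti-self-dual precisely when it vanishes on the corresponding null direction. Since
the flow preserves its own generator, the operator annihilates the `1`-forms that vanish on it, and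
maps `2`-forms to such `1`-forms. Supports move along orbits, which are null curves. Reversing time
exchanges the forward and backward operators, and the direction with its opposite.
-/

noncomputable section

/-! ### Parametric integrals and fiber integration on a product -/

section Euclidean

variable {E F : Type*} [NormedAddCommGroup E] [NormedSpace ℝ E]
  [NormedAddCommGroup F] [NormedSpace ℝ F] {U : Set E} {y : E}

lemma hasFDerivAt_of_contDiffOn_univ_prod (hU : IsOpen U) {f : ℝ × E → F}
    (hf : ContDiffOn ℝ 1 f (univ ×ˢ U)) (s : ℝ) (hy : y ∈ U) :
    HasFDerivAt f (fderiv ℝ f (s, y)) (s, y) :=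
  ((hf.contDiffAt ((isOpen_univ.prod hU).mem_nhds ⟨mem_univ s, hy⟩)).differentiableAt
    one_ne_zero).hasFDerivAt

lemma continuous_fderiv_slice (hU : IsOpen U) {f : ℝ × E → F}
    (hf : ContDiffOn ℝ 1 f (univ ×ˢ U)) (hy : y ∈ U) :
    Continuous fun s : ℝ => fderiv ℝ f (s, y) :=
  (hf.continuousOn_fderiv_of_isOpen (isOpen_univ.prod hU) le_rfl).comp_continuous
    (f := fun s : ℝ => (s, y)) (by fun_prop) fun s => ⟨mem_univ s, hy⟩

lemma exists_eventually_norm_fderiv_lt (hU : IsOpen U) {f : ℝ × E → F}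
    (hf : ContDiffOn ℝ 1 f (univ ×ˢ U)) {I : Set ℝ} (hI : IsCompact I) (hy : y ∈ U) :
    ∃ C, ∀ᶠ z in 𝓝 y, ∀ s ∈ I, ‖fderiv ℝ f (s, z)‖ < C := by
  obtain ⟨C, hC⟩ := hI.exists_bound_of_continuousOn (continuous_fderiv_slice hU hf hy).continuousOn
  refine ⟨C + 1, hI.eventually_forall_of_forall_eventually fun s hs => ?_⟩
  have hopen : IsOpen ((univ : Set ℝ) ×ˢ U) := isOpen_univ.prod hU
  have hcont : ContinuousAt (fderiv ℝ f) (s, y) :=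
    (hf.continuousOn_fderiv_of_isOpen hopen le_rfl).continuousAt
      (hopen.mem_nhds ⟨mem_univ s, hy⟩)
  exact (continuous_swap.tendsto (y, s)).eventually
    (hcont.norm.eventually_lt_const ((hC s hs).trans_lt (lt_add_one C)))

lemma hasFDerivAt_parametric_intervalIntegral (hU : IsOpen U) {f : ℝ × E → F}
    (hf : ContDiffOn ℝ 1 f (univ ×ˢ U)) (a b : ℝ) (hy : y ∈ U) :
    HasFDerivAt (fun z => ∫ s in a..b, f (s, z))
      (∫ s in a..b, (fderiv ℝ f (s, y)).comp (.inr ℝ ℝ E)) y := by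
  have hslice : ∀ z ∈ U, Continuous fun s : ℝ => f (s, z) := fun z hz =>
    hf.continuousOn.comp_continuous (by fun_prop) fun s => ⟨mem_univ s, hz⟩
  obtain ⟨C, hC⟩ := exists_eventually_norm_fderiv_lt hU hf (isCompact_uIcc (a := a) (b := b)) hy
  refine intervalIntegral.hasFDerivAt_integral_of_dominated_of_fderiv_le
    (bound := fun _ => C * ‖ContinuousLinearMap.inr ℝ ℝ E‖)
    (F' := fun z s => (fderiv ℝ f (s, z)).comp (.inr ℝ ℝ E))
    (Filter.inter_mem hC (hU.mem_nhds hy)) ?_ ((hslice y hy).intervalIntegrable _ _)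
    ((continuous_fderiv_slice hU hf hy).clm_comp continuous_const).aestronglyMeasurable ?_
    intervalIntegrable_const ?_
  · filter_upwards [hU.mem_nhds hy] with z hz using (hslice z hz).aestronglyMeasurable
  · exact .of_forall fun s hs z hz => (ContinuousLinearMap.opNorm_comp_le _ _).trans <|
      mul_le_mul_of_nonneg_right (hz.1 s (uIoc_subset_uIcc hs)).le (norm_nonneg _)
  · exact .of_forall fun s _ z hz => (hasFDerivAt_of_contDiffOn_univ_prod hU hf s hz.2).comp z
      (hasFDerivAt_prodMk_right s z)

lemma clm_fderiv_parametric_intervalIntegral [CompleteSpace F] {G : Type*} [NormedAddCommGroup G]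
    [NormedSpace ℝ G] [CompleteSpace G] (A : (E →L[ℝ] F) →L[ℝ] G) (hU : IsOpen U) {f : ℝ × E → F}
    (hf : ContDiffOn ℝ 1 f (univ ×ˢ U)) (a b : ℝ) (hy : y ∈ U) :
    A (fderiv ℝ (fun z => ∫ s in a..b, f (s, z)) y) =
      ∫ s in a..b, A (fderiv ℝ (fun z => f (s, z)) y) := by
  have hcont : Continuous fun s => (fderiv ℝ f (s, y)).comp (.inr ℝ ℝ E) :=
    (continuous_fderiv_slice hU hf hy).clm_comp continuous_const
  have hslice (s : ℝ) : fderiv ℝ (fun z => f (s, z)) y = (fderiv ℝ f (s, y)).comp (.inr ℝ ℝ E) :=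
    ((hasFDerivAt_of_contDiffOn_univ_prod hU hf s hy).comp y (hasFDerivAt_prodMk_right s y)).fderiv
  simp only [hslice, (hasFDerivAt_parametric_intervalIntegral hU hf a b hy).fderiv]
  exact (A.intervalIntegral_comp_comm (hcont.intervalIntegrable a b)).symm

lemma contDiffOn_parametric_intervalIntegral {E F : Type u} [NormedAddCommGroup E]
    [NormedSpace ℝ E] [NormedAddCommGroup F] [NormedSpace ℝ F] {U : Set E} (hU : IsOpen U)
    {f : ℝ × E → F} (hf : ContDiffOn ℝ ∞ f (univ ×ˢ U)) (a b : ℝ) :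
    ContDiffOn ℝ ∞ (fun y => ∫ s in a..b, f (s, y)) U := by
  refine contDiffOn_infty.2 fun n => ?_
  induction n generalizing F with
  | zero =>
    exact contDiffOn_zero.2 fun y hy => (hasFDerivAt_parametric_intervalIntegral hU
      (hf.of_le (by simp)) a b hy).continuousAt.continuousWithinAt
  | succ n ih =>
    have hderiv := fun y (hy : y ∈ U) =>
      hasFDerivAt_parametric_intervalIntegral hU (hf.of_le (by simp)) a b hy
    refine (contDiffOn_succ_iff_fderiv_of_isOpen (n := n) hU).2
      ⟨fun y hy => (hderiv y hy).differentiableAt.differentiableWithinAt, by simp, ?_⟩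
    have hfderiv := hf.fderiv_of_isOpen (isOpen_univ.prod hU) (m := ∞) (by simp)
    exact (ih (hfderiv.clm_comp (contDiffOn_const (c := .inr ℝ ℝ E)))).congr
      fun y hy => (hderiv y hy).fderiv

/-- Alternatization `f ↦ ∑ σ, sign σ • f ∘ σ` as a continuous linear map. -/
def alternatizationCLM {ι : Type*} [Fintype ι] [DecidableEq ι] :
    ContinuousMultilinearMap ℝ (fun _ : ι => E) F →L[ℝ] E [⋀^ι]→L[ℝ] F :=
  ContinuousMultilinearMap.alternatization.toRealLinearMap <| by
    refine ContinuousAlternatingMap.isEmbedding_toContinuousMultilinearMap.continuous_iff.2 ?_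
    exact continuous_finsetSum _ fun σ _ =>
      (ContinuousMultilinearMap.domDomCongrₗᵢ ℝ E F σ).continuous.const_smul (Equiv.Perm.sign σ)

lemma alternatizationCLM_toContinuousMultilinearMap {ι : Type*} [Fintype ι] [DecidableEq ι]
    (f : E [⋀^ι]→L[ℝ] F) :
    alternatizationCLM f.toContinuousMultilinearMap = (Fintype.card ι).factorial • f := by
  ext v
  have hperm (σ : Equiv.Perm ι) : Equiv.Perm.sign σ • f (v ∘ σ) = f v := by
    rw [← f.coe_toAlternatingMap, f.toAlternatingMap.map_perm, smul_smul,
      Int.units_mul_self, one_smul]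
  simp only [alternatizationCLM, AddMonoidHom.coe_toRealLinearMap,
    ContinuousMultilinearMap.alternatization_apply_apply,
    ContinuousAlternatingMap.coe_toContinuousMultilinearMap, hperm, Finset.sum_const,
    Finset.card_univ, Fintype.card_perm]
  rfl

/-- Smoothness is available for the pullback of multilinear maps; alternatization, which multiplies
alternating maps by a factorial, carries it over to alternating ones. -/
lemma contDiffOn_compContinuousLinearMap {X G ι : Type*} [NormedAddCommGroup X]
    [NormedSpace ℝ X] [NormedAddCommGroup G] [NormedSpace ℝ G] [Fintype ι]
    {n : WithTop ℕ∞} {s : Set X} {f : X → F [⋀^ι]→L[ℝ] G} {g : X → E →L[ℝ] F}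
    (hf : ContDiffOn ℝ n f s) (hg : ContDiffOn ℝ n g s) :
    ContDiffOn ℝ n (fun x => (f x).compContinuousLinearMap (g x)) s := by
  classical
  have hcomp : ContDiffOn ℝ n (fun x =>
      ContinuousMultilinearMap.compContinuousLinearMapContinuousMultilinear ℝ
        (fun _ : ι => E) (fun _ => F) G (fun _ => g x)) s :=
    (ContinuousMultilinearMap.contDiff _).comp_contDiffOn (contDiffOn_pi.2 fun _ => hg)
  have hmulti : ContDiffOn ℝ n (fun x => (f x).toContinuousMultilinearMap) s :=
    (ContinuousAlternatingMap.toContinuousMultilinearMapCLM (𝕜 := ℝ) (E := F) (F := G)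
      (ι := ι) ℝ).contDiff.comp_contDiffOn hf
  have halt := (alternatizationCLM (E := E) (F := G) (ι := ι)).contDiff.comp_contDiffOn
    (hcomp.clm_apply hmulti)
  refine (halt.const_smul ((Fintype.card ι).factorial : ℝ)⁻¹).congr fun x _ => ?_
  have hself := alternatizationCLM_toContinuousMultilinearMap ((f x).compContinuousLinearMap (g x))
  rw [← Nat.cast_smul_eq_nsmul ℝ] at hself
  exact (inv_smul_eq_iff₀ (by positivity)).2 hself |>.symm

/-- The form `ι_{∂/∂s} β` on `ℝ × E`, restricted to the second factor. This is the integrand of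
fiber integration along `ℝ × E → E`, with the fiber direction in the first slot. -/
def fiberContraction {k : ℕ} :
    (ℝ × E) [⋀^Fin (k + 1)]→L[ℝ] F →L[ℝ] E [⋀^Fin k]→L[ℝ] F :=
  (ContinuousAlternatingMap.compContinuousLinearMapCLM (.inr ℝ ℝ E)).comp
    ((ContinuousLinearMap.apply ℝ _ ((1 : ℝ), (0 : E))).comp
      (ContinuousAlternatingMap.curryLeftLI (𝕜 := ℝ) (E := ℝ × E) (F := F)
        (n := k)).toContinuousLinearMap)

lemma fiberContraction_apply {k : ℕ} (β : (ℝ × E) [⋀^Fin (k + 1)]→L[ℝ] F) (v : Fin k → E) :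
    fiberContraction β v = β (Fin.cons ((1 : ℝ), (0 : E)) fun i => ((0 : ℝ), v i)) := rfl

/-- Restriction of a form on `ℝ × E` to the second factor, that is, its pullback to the slices
`{s} × E`. -/
def fiberRestriction {k : ℕ} : (ℝ × E) [⋀^Fin k]→L[ℝ] F →L[ℝ] E [⋀^Fin k]→L[ℝ] F :=
  ContinuousAlternatingMap.compContinuousLinearMapCLM (.inr ℝ ℝ E)

lemma fiberRestriction_apply {k : ℕ} (β : (ℝ × E) [⋀^Fin k]→L[ℝ] F) (v : Fin k → E) :
    fiberRestriction β v = β fun i => ((0 : ℝ), v i) := rfl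

/-- Cartan's formula `d ι_{∂/∂s} + ι_{∂/∂s} d = ∂/∂s`, with `D` the derivative of the form at a
point. -/
lemma alternatizeUncurryFin_fiberContraction_add {k : ℕ}
    (D : ℝ × E →L[ℝ] (ℝ × E) [⋀^Fin (k + 1)]→L[ℝ] F) :
    ContinuousAlternatingMap.alternatizeUncurryFin
        (fiberContraction.comp (D.comp (.inr ℝ ℝ E))) +
      fiberContraction (ContinuousAlternatingMap.alternatizeUncurryFin D) =
    fiberRestriction (D (1, 0)) := by
  ext v
  have hremove_succ (i : Fin (k + 1)) : i.succ.removeNth (α := fun _ => ℝ × E)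
      (Fin.cons ((1 : ℝ), (0 : E)) fun i => ((0 : ℝ), v i)) =
      Fin.cons ((1 : ℝ), (0 : E)) fun j => ((0 : ℝ), i.removeNth v j) := by
    funext j
    refine Fin.cases ?_ (fun j => ?_) j <;> simp [Fin.removeNth]
  have hremove_zero : (0 : Fin (k + 2)).removeNth (α := fun _ => ℝ × E)
      (Fin.cons ((1 : ℝ), (0 : E)) fun i => ((0 : ℝ), v i)) = fun i => ((0 : ℝ), v i) := by
    funext j
    simp [Fin.removeNth]
  have happly (i : Fin (k + 1)) :
      (fiberContraction.comp (D.comp (.inr ℝ ℝ E)) (v i)) (i.removeNth v) =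
        D (0, v i) (Fin.cons ((1 : ℝ), (0 : E)) fun j => ((0 : ℝ), i.removeNth v j)) := rfl
  rw [ContinuousAlternatingMap.add_apply, ContinuousAlternatingMap.alternatizeUncurryFin_apply,
    fiberContraction_apply, ContinuousAlternatingMap.alternatizeUncurryFin_apply,
    Fin.sum_univ_succ (n := k + 1), fiberRestriction_apply]
  simp only [hremove_succ, hremove_zero, happly, Fin.val_zero, pow_zero, one_smul, Fin.cons_zero,
    Fin.cons_succ, Fin.val_succ, pow_succ, mul_neg, mul_one, neg_smul, Finset.sum_neg_distrib]
  abel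

lemma fiberContraction_alternatizeUncurryFin_zero
    (D : ℝ × E →L[ℝ] (ℝ × E) [⋀^Fin 0]→L[ℝ] F) :
    fiberContraction (ContinuousAlternatingMap.alternatizeUncurryFin D) =
    fiberRestriction (D (1, 0)) := by
  ext v
  rw [fiberContraction_apply, ContinuousAlternatingMap.alternatizeUncurryFin_apply,
    fiberRestriction_apply, Fin.sum_univ_one, Fin.val_zero, pow_zero, one_smul, Fin.cons_zero]
  exact congrArg _ (Subsingleton.elim _ _)

variable {k : ℕ}

lemma extDeriv_fiberContraction_add (hU : IsOpen U)
    {β : ℝ × E → (ℝ × E) [⋀^Fin (k + 1)]→L[ℝ] F} (hβ : ContDiffOn ℝ 1 β (univ ×ˢ U)) (s : ℝ)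
    (hy : y ∈ U) :
    extDeriv (fun z => fiberContraction (β (s, z))) y + fiberContraction (extDeriv β (s, y)) =
      fiberRestriction (fderiv ℝ β (s, y) (1, 0)) := by
  have hfderiv : fderiv ℝ (fun z => fiberContraction (β (s, z))) y =
      fiberContraction.comp ((fderiv ℝ β (s, y)).comp (.inr ℝ ℝ E)) :=
    ((fiberContraction (E := E) (F := F) (k := k)).hasFDerivAt.comp y
      ((hasFDerivAt_of_contDiffOn_univ_prod hU hβ s hy).comp y
        (hasFDerivAt_prodMk_right s y))).fderiv
  rw [extDeriv, hfderiv]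
  exact alternatizeUncurryFin_fiberContraction_add (fderiv ℝ β (s, y))

lemma continuous_fiberContraction_extDeriv (hU : IsOpen U)
    {β : ℝ × E → (ℝ × E) [⋀^Fin k]→L[ℝ] F} (hβ : ContDiffOn ℝ 1 β (univ ×ˢ U)) (hy : y ∈ U) :
    Continuous fun s : ℝ => fiberContraction (extDeriv β (s, y)) :=
  (fiberContraction (E := E) (F := F) (k := k)).continuous.comp <|
    (ContinuousAlternatingMap.alternatizeUncurryFinCLM ℝ (ℝ × E) F).continuous.comp
      (continuous_fderiv_slice hU hβ hy)

lemma continuous_extDeriv_slice (hU : IsOpen U) {η : ℝ × E → E [⋀^Fin k]→L[ℝ] F}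
    (hη : ContDiffOn ℝ 1 η (univ ×ˢ U)) (hy : y ∈ U) :
    Continuous fun s : ℝ => extDeriv (fun z => η (s, z)) y := by
  have hfderiv (s : ℝ) : fderiv ℝ (fun z => η (s, z)) y = (fderiv ℝ η (s, y)).comp (.inr ℝ ℝ E) :=
    ((hasFDerivAt_of_contDiffOn_univ_prod hU hη s hy).comp y (hasFDerivAt_prodMk_right s y)).fderiv
  simp only [extDeriv, hfderiv]
  exact (ContinuousAlternatingMap.alternatizeUncurryFinCLM ℝ E F).continuous.comp
    ((continuous_fderiv_slice hU hη hy).clm_comp continuous_const)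

variable [CompleteSpace F]

lemma extDeriv_parametric_intervalIntegral (hU : IsOpen U) {η : ℝ × E → E [⋀^Fin k]→L[ℝ] F}
    (hη : ContDiffOn ℝ 1 η (univ ×ˢ U)) (a b : ℝ) (hy : y ∈ U) :
    extDeriv (fun z => ∫ s in a..b, η (s, z)) y =
      ∫ s in a..b, extDeriv (fun z => η (s, z)) y :=
  clm_fderiv_parametric_intervalIntegral
    (ContinuousAlternatingMap.alternatizeUncurryFinCLM ℝ E F) hU hη a b hy

lemma intervalIntegral_fiberRestriction_fderiv (hU : IsOpen U)
    {β : ℝ × E → (ℝ × E) [⋀^Fin k]→L[ℝ] F} (hβ : ContDiffOn ℝ 1 β (univ ×ˢ U)) (a b : ℝ)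
    (hy : y ∈ U) :
    ∫ s in a..b, fiberRestriction (fderiv ℝ β (s, y) (1, 0)) =
      fiberRestriction (β (b, y)) - fiberRestriction (β (a, y)) := by
  refine intervalIntegral.integral_eq_sub_of_hasDerivAt
    (f := fun s => fiberRestriction (β (s, y))) (fun s _ => ?_) ?_
  · exact (fiberRestriction (E := E) (F := F) (k := k)).hasFDerivAt.comp_hasDerivAt s
      ((hasFDerivAt_of_contDiffOn_univ_prod hU hβ s hy).comp_hasDerivAt s
        ((hasDerivAt_id s).prodMk (hasDerivAt_const s y)))
  · exact ((fiberRestriction (E := E) (F := F) (k := k)).continuous.comp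
      ((continuous_fderiv_slice hU hβ hy).clm_apply continuous_const)).intervalIntegrable _ _

lemma extDeriv_intervalIntegral_fiberContraction_add (hU : IsOpen U)
    {β : ℝ × E → (ℝ × E) [⋀^Fin (k + 1)]→L[ℝ] F} (hβ : ContDiffOn ℝ 1 β (univ ×ˢ U)) (a b : ℝ)
    (hy : y ∈ U) :
    extDeriv (fun z => ∫ s in a..b, fiberContraction (β (s, z))) y +
      ∫ s in a..b, fiberContraction (extDeriv β (s, y)) =
      fiberRestriction (β (b, y)) - fiberRestriction (β (a, y)) := by
  have hcontr : ContDiffOn ℝ 1 (fun x => fiberContraction (β x)) (univ ×ˢ U) :=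
    (fiberContraction (E := E) (F := F) (k := k)).contDiff.comp_contDiffOn hβ
  rw [extDeriv_parametric_intervalIntegral hU hcontr a b hy,
    ← intervalIntegral_fiberRestriction_fderiv hU hβ a b hy,
    ← intervalIntegral.integral_add
      ((continuous_extDeriv_slice hU hcontr hy).intervalIntegrable a b)
      ((continuous_fiberContraction_extDeriv hU hβ hy).intervalIntegrable a b)]
  exact intervalIntegral.integral_congr fun s _ => extDeriv_fiberContraction_add hU hβ s hy

lemma intervalIntegral_fiberContraction_extDeriv_zero (hU : IsOpen U)
    {β : ℝ × E → (ℝ × E) [⋀^Fin 0]→L[ℝ] F} (hβ : ContDiffOn ℝ 1 β (univ ×ˢ U)) (a b : ℝ)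
    (hy : y ∈ U) :
    ∫ s in a..b, fiberContraction (extDeriv β (s, y)) =
      fiberRestriction (β (b, y)) - fiberRestriction (β (a, y)) := by
  rw [← intervalIntegral_fiberRestriction_fderiv hU hβ a b hy]
  exact intervalIntegral.integral_congr fun s _ =>
    fiberContraction_alternatizeUncurryFin_zero (fderiv ℝ β (s, y))

end Euclidean

local notation "ℝ²" => EuclideanSpace ℝ (Fin 2)

/-! ### Pullback of forms to normed spaces -/

section Pullback

variable {N : Type u} [TopologicalSpace N] [ChartedSpace ℝ² N]
  {W : Type*} [NormedAddCommGroup W] [NormedSpace ℝ W] {k : ℕ}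

lemma RawForm.eq_zero_of_notMem_supp {α : RawForm N k} {p : N} (h : p ∉ α.supp) : α p = 0 :=
  of_not_not fun hne => h (subset_closure hne)

lemma RawForm.extd_neg (α : RawForm N k) : (-α).extd = -α.extd := by
  have hneg {m : ℕ} (β : RawForm N m) : -β = (-1 : ℝ) • β :=
    funext fun p => (neg_one_smul ℝ (β p)).symm
  rw [hneg, hneg, RawForm.extd_smul]

lemma RawForm.supp_neg (α : RawForm N k) : (-α).supp = α.supp := by
  simp only [RawForm.supp, Pi.neg_apply, ne_eq, neg_eq_zero]

/-- The pullback of a form on `N` along a map `f : W → N`. It allows exterior derivatives of forms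
on `ℝ × N` to be computed in `ℝ × ℝ²`. -/
def RawForm.pullback (α : RawForm N k) (f : W → N) (x : W) : W [⋀^Fin k]→L[ℝ] ℝ :=
  (α (f x)).compContinuousLinearMap (mfderiv 𝓘(ℝ, W) (𝓡 2) f x)

lemma RawForm.pullback_apply (α : RawForm N k) (f : W → N) (x : W) (v : Fin k → W) :
    α.pullback f x v = α (f x) fun i => mfderiv 𝓘(ℝ, W) (𝓡 2) f x (v i) := rfl

lemma RawForm.chartRep_eq_pullback (α : RawForm N k) (c : N) :
    α.chartRep c = α.pullback (extChartAt (𝓡 2) c).symm := rfl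

lemma RawForm.pullback_eq_zero {α : RawForm N k} {f : W → N} {x : W} (h : α (f x) = 0) :
    α.pullback f x = 0 := by
  rw [RawForm.pullback, h]
  rfl

lemma RawForm.pullback_comp {V : Type*} [NormedAddCommGroup V] [NormedSpace ℝ V]
    (α : RawForm N k) {f : W → N} {g : V → W} {x : V}
    (hf : MDifferentiableAt 𝓘(ℝ, W) (𝓡 2) f (g x)) (hg : DifferentiableAt ℝ g x) :
    α.pullback (f ∘ g) x = (α.pullback f (g x)).compContinuousLinearMap (fderiv ℝ g x) := by
  rw [RawForm.pullback, mfderiv_comp x hf hg.mdifferentiableAt, mfderiv_eq_fderiv]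
  rfl

variable {f : W → N} {O : Set W}

variable [IsManifold (𝓡 2) ∞ N]

lemma RawForm.ext_chartRep {α β : RawForm N k}
    (h : ∀ p, α.chartRep p (extChartAt (𝓡 2) p p) = β.chartRep p (extChartAt (𝓡 2) p p)) :
    α = β := by
  funext p
  rw [← RawForm.chartRep_comp_mfderiv α p (mem_extChartAt_source p),
    ← RawForm.chartRep_comp_mfderiv β p (mem_extChartAt_source p), h]

lemma contDiffOn_extChartAt_comp (hf : ContMDiffOn 𝓘(ℝ, W) (𝓡 2) ∞ f O) (c : N) :
    ContDiffOn ℝ ∞ (extChartAt (𝓡 2) c ∘ f) (O ∩ f ⁻¹' (extChartAt (𝓡 2) c).source) := by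
  rw [← contMDiffOn_iff_contDiffOn]
  refine ContMDiffOn.comp (t := (extChartAt (𝓡 2) c).source) ?_ (hf.mono inter_subset_left)
    inter_subset_right
  rw [extChartAt_source]
  exact contMDiffOn_extChartAt

lemma RawForm.pullback_eq_chartRep (α : RawForm N k) (hO : IsOpen O)
    (hf : ContMDiffOn 𝓘(ℝ, W) (𝓡 2) ∞ f O) (c : N) {x : W}
    (hx : x ∈ O ∩ f ⁻¹' (extChartAt (𝓡 2) c).source) :
    α.pullback f x = (α.chartRep c ((extChartAt (𝓡 2) c ∘ f) x)).compContinuousLinearMap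
      (fderiv ℝ (extChartAt (𝓡 2) c ∘ f) x) := by
  have hfx : MDifferentiableAt 𝓘(ℝ, W) (𝓡 2) f x :=
    (hf.contMDiffAt (hO.mem_nhds hx.1)).mdifferentiableAt (by simp)
  have hc : MDifferentiableAt (𝓡 2) 𝓘(ℝ, ℝ²) (extChartAt (𝓡 2) c) (f x) :=
    (contMDiffAt_extChartAt' (n := ∞) (extChartAt_source (𝓡 2) c ▸ hx.2)).mdifferentiableAt
      (by simp)
  rw [← mfderiv_eq_fderiv, mfderiv_comp x hc hfx, RawForm.pullback,
    ← RawForm.chartRep_comp_mfderiv α c hx.2]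
  rfl

lemma RawForm.IsSmooth.contDiffOn_pullback {α : RawForm N k} (hα : α.IsSmooth)
    (hO : IsOpen O) (hf : ContMDiffOn 𝓘(ℝ, W) (𝓡 2) ∞ f O) :
    ContDiffOn ℝ ∞ (α.pullback f) O := by
  intro x hx
  set V := O ∩ f ⁻¹' (extChartAt (𝓡 2) (f x)).source
  have hV : IsOpen V := hf.continuousOn.isOpen_inter_preimage hO (isOpen_extChartAt_source (f x))
  have hchart := contDiffOn_extChartAt_comp hf (f x)
  have hrep : ContDiffOn ℝ ∞ (fun z => α.chartRep (f x) ((extChartAt (𝓡 2) (f x) ∘ f) z)) V :=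
    (hα (f x)).comp hchart fun z hz => (extChartAt (𝓡 2) (f x)).map_source hz.2
  have hpullback : ContDiffOn ℝ ∞ (α.pullback f) V :=
    (contDiffOn_compContinuousLinearMap hrep (hchart.fderiv_of_isOpen hV (by simp))).congr
      fun z hz => α.pullback_eq_chartRep hO hf (f x) hz
  exact (hpullback.contDiffAt (hV.mem_nhds ⟨hx, mem_extChartAt_source (f x)⟩)).contDiffWithinAt

lemma RawForm.IsSmooth.extDeriv_pullback {α : RawForm N k} (hα : α.IsSmooth)
    (hO : IsOpen O) (hf : ContMDiffOn 𝓘(ℝ, W) (𝓡 2) ∞ f O) {x : W} (hx : x ∈ O) :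
    extDeriv (α.pullback f) x = α.extd.pullback f x := by
  have hxV : x ∈ O ∩ f ⁻¹' (extChartAt (𝓡 2) (f x)).source := ⟨hx, mem_extChartAt_source (f x)⟩
  have hV := (hf.continuousOn.isOpen_inter_preimage hO
    (isOpen_extChartAt_source (f x))).mem_nhds hxV
  have hrep : α.pullback f =ᶠ[𝓝 x] fun z =>
      (α.chartRep (f x) ((extChartAt (𝓡 2) (f x) ∘ f) z)).compContinuousLinearMap
        (fderiv ℝ (extChartAt (𝓡 2) (f x) ∘ f) z) := by
    filter_upwards [hV] with z hz using α.pullback_eq_chartRep hO hf (f x) hz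
  have htarget := mem_extChartAt_target (I := 𝓡 2) (f x)
  have hdiff : DifferentiableAt ℝ (α.chartRep (f x)) ((extChartAt (𝓡 2) (f x) ∘ f) x) :=
    ((hα (f x)).contDiffAt ((isOpen_extChartAt_target (f x)).mem_nhds htarget)).differentiableAt
      (by simp)
  rw [hrep.extDeriv_eq, _root_.extDeriv_pullback hdiff
      ((contDiffOn_extChartAt_comp hf (f x)).contDiffAt hV)
      (by simp only [minSmoothness_of_isRCLikeNormedField]; exact WithTop.coe_le_coe.2 le_top),
    α.extd.pullback_eq_chartRep hO hf (f x) hxV]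
  exact congrArg (ContinuousAlternatingMap.compContinuousLinearMap · _)
    (RawForm.chartRep_extd hα (f x) htarget).symm

end Pullback

/-! ### Integration of forms along a proper flow -/

section FlowIntegral

variable {N : Type u} [TopologicalSpace N] [ChartedSpace ℝ² N] {Θ : ℝ × N → N} {k : ℕ}

/-- The form `ι_{∂/∂s} Θ^* α` restricted to the slice `{s} × N`. It is the integrand of the fiber
integral of `Θ^* α` along the projection to `N`. -/
def flowIntegrand (Θ : ℝ × N → N) (α : RawForm N (k + 1)) (p : N) (s : ℝ) : ℝ² [⋀^Fin k]→L[ℝ] ℝ :=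
  fiberContraction (show (ℝ × ℝ²) [⋀^Fin (k + 1)]→L[ℝ] ℝ from flowPullback Θ α (s, p))

/-- The form `∫_{s ≤ 0} Θ^* α`, whose value at `p` only involves the past half of the orbit of `p`.
It is a Bochner integral of alternating maps, whereas `forwardG` integrates after evaluation. -/
def pastIntegral (Θ : ℝ × N → N) (α : RawForm N (k + 1)) : RawForm N k := fun p =>
  (show ℝ² [⋀^Fin k]→L[ℝ] ℝ from ∫ s in Iic (0 : ℝ), flowIntegrand Θ α p s)

/-- The points whose past orbit meets `K`, so that `K` flows into them. -/
def flowFuture (Θ : ℝ × N → N) (K : Set N) : Set N := {q | ∃ s ≤ 0, Θ (s, q) ∈ K}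

/-- The flow `Θ` with space variable read in the chart around `c`. Both chart and flow parameter
then range over normed spaces. -/
def chartFlow (Θ : ℝ × N → N) (c : N) (x : ℝ × ℝ²) : N :=
  Θ (x.1, (extChartAt (𝓡 2) c).symm x.2)

lemma flowIntegrand_apply (Θ : ℝ × N → N) (α : RawForm N (k + 1)) (p : N) (s : ℝ)
    (v : Fin k → ℝ²) :
    flowIntegrand Θ α p s v = flowPullback Θ α (s, p)
      (Fin.cons (show TangentSpace (𝓘(ℝ, ℝ).prod (𝓡 2)) (s, p) from ((1 : ℝ), 0))
        fun i => (show TangentSpace (𝓘(ℝ, ℝ).prod (𝓡 2)) (s, p) from ((0 : ℝ), v i))) := rfl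

lemma flowIntegrand_eq_zero {α : RawForm N (k + 1)} {p : N} {s : ℝ} (h : Θ (s, p) ∉ α.supp) :
    flowIntegrand Θ α p s = 0 := by
  ext v
  rw [flowIntegrand_apply, flowPullback, RawForm.eq_zero_of_notMem_supp h]
  rfl

lemma pastIntegral_smul (Θ : ℝ × N → N) (a : ℝ) (α : RawForm N (k + 1)) :
    pastIntegral Θ (a • α) = a • pastIntegral Θ α :=
  funext fun p => integral_smul a (flowIntegrand Θ α p)

lemma IsProperFlow.exists_bound (hp : IsProperFlow Θ) {K : Set N} (hK : IsCompact K) (p : N) :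
    ∃ R > 0, ∀ᶠ q in 𝓝 p, ∀ s, Θ (s, q) ∈ K → |s| < R := by
  have : LocallyCompactSpace N := Manifold.locallyCompact_of_finiteDimensional (𝓡 2)
  obtain ⟨L, hL, hLp⟩ := exists_compact_mem_nhds p
  have htimes : IsCompact (Prod.fst '' ((fun x : ℝ × N => (x.2, Θ x)) ⁻¹' (L ×ˢ K))) :=
    (hp.isCompact_preimage (hL.prod hK)).image continuous_fst
  obtain ⟨R, hRpos, hR⟩ := htimes.isBounded.exists_pos_norm_lt
  refine ⟨R, hRpos, ?_⟩
  filter_upwards [hLp] with q hq s hs using hR s ⟨(s, q), ⟨hq, hs⟩, rfl⟩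

lemma IsProperFlow.exists_chart_bound (hp : IsProperFlow Θ) {K : Set N} (hK : IsCompact K)
    (c : N) {y : ℝ²} (hy : y ∈ (extChartAt (𝓡 2) c).target) :
    ∃ R > 0, ∀ᶠ z in 𝓝 y, z ∈ (extChartAt (𝓡 2) c).target ∧
      ∀ s, Θ (s, (extChartAt (𝓡 2) c).symm z) ∈ K → |s| < R := by
  obtain ⟨R, hR, hbound⟩ := hp.exists_bound hK ((extChartAt (𝓡 2) c).symm y)
  exact ⟨R, hR, ((isOpen_extChartAt_target c).eventually_mem hy).and
    ((continuousAt_extChartAt_symm'' hy).eventually hbound)⟩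

lemma IsProperFlow.isClosed_flowFuture (hp : IsProperFlow Θ) (hΘ : Continuous Θ)
    {K : Set N} (hK : IsCompact K) (hKclosed : IsClosed K) : IsClosed (flowFuture Θ K) := by
  rw [← isOpen_compl_iff, isOpen_iff_mem_nhds]
  intro p hpK
  obtain ⟨R, -, hbound⟩ := hp.exists_bound hK p
  have hshort : ∀ᶠ q in 𝓝 p, ∀ s ∈ Icc (-R) 0, Θ (s, q) ∉ K := by
    refine isCompact_Icc.eventually_forall_of_forall_eventually fun s hs => ?_
    have hswap : Continuous fun z : N × ℝ => Θ (z.2, z.1) := by fun_prop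
    exact (hKclosed.isOpen_compl.preimage hswap).mem_nhds fun hmem => hpK ⟨s, hs.2, hmem⟩
  filter_upwards [hbound, hshort] with q hq hq'
  rintro ⟨s, hs, hsK⟩
  exact hq' s ⟨(abs_lt.1 (hq s hsK)).1.le, hs⟩ hsK

lemma supp_pastIntegral_subset (hp : IsProperFlow Θ) (hΘ : Continuous Θ)
    {α : RawForm N (k + 1)} (hα : IsCompact α.supp) :
    (pastIntegral Θ α).supp ⊆ flowFuture Θ α.supp := by
  refine closure_minimal (fun q hq => ?_) (hp.isClosed_flowFuture hΘ hα isClosed_closure)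
  by_contra hfuture
  exact hq (setIntegral_eq_zero_of_forall_eq_zero (E := ℝ² [⋀^Fin k]→L[ℝ] ℝ) fun s hs =>
    flowIntegrand_eq_zero fun hmem => hfuture ⟨s, hs, hmem⟩)

lemma pastIntegral_eq_intervalIntegral {α : RawForm N (k + 1)} {p : N} {R : ℝ} (hR : 0 < R)
    (hbound : ∀ s, Θ (s, p) ∈ α.supp → |s| < R) :
    pastIntegral Θ α p =
      (show ℝ² [⋀^Fin k]→L[ℝ] ℝ from ∫ s in (-R)..0, flowIntegrand Θ α p s) := by
  rw [intervalIntegral.integral_of_le (by linarith)]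
  exact setIntegral_eq_of_subset_of_forall_sdiff_eq_zero (E := ℝ² [⋀^Fin k]→L[ℝ] ℝ)
    measurableSet_Iic (fun s hs => hs.2) fun s hs =>
      flowIntegrand_eq_zero fun hmem => hs.2 ⟨(abs_lt.1 (hbound s hmem)).1, hs.1⟩

lemma isOpen_univ_prod_extChartAt_target (c : N) :
    IsOpen ((univ : Set ℝ) ×ˢ (extChartAt (𝓡 2) c).target) :=
  isOpen_univ.prod (isOpen_extChartAt_target c)

variable [IsManifold (𝓡 2) ∞ N]

lemma contMDiffOn_chartFlow (hΘ : ContMDiff (𝓘(ℝ, ℝ).prod (𝓡 2)) (𝓡 2) ∞ Θ) (c : N) :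
    ContMDiffOn 𝓘(ℝ, ℝ × ℝ²) (𝓡 2) ∞ (chartFlow Θ c) (univ ×ˢ (extChartAt (𝓡 2) c).target) :=
  hΘ.comp_contMDiffOn <| ContMDiffOn.prodMk
    (contMDiff_iff_contDiff.2 contDiff_fst).contMDiffOn
    ((contMDiffOn_extChartAt_symm c).comp (contMDiff_iff_contDiff.2 contDiff_snd).contMDiffOn
      fun _ hx => hx.2)

lemma RawForm.IsSmooth.contDiffOn_pullback_chartFlow {α : RawForm N k} (hα : α.IsSmooth)
    (hΘ : ContMDiff (𝓘(ℝ, ℝ).prod (𝓡 2)) (𝓡 2) ∞ Θ) (c : N) :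
    ContDiffOn ℝ ∞ (α.pullback (chartFlow Θ c)) (univ ×ˢ (extChartAt (𝓡 2) c).target) :=
  hα.contDiffOn_pullback (isOpen_univ_prod_extChartAt_target c) (contMDiffOn_chartFlow hΘ c)

lemma mfderiv_chartFlow (hΘ : ContMDiff (𝓘(ℝ, ℝ).prod (𝓡 2)) (𝓡 2) ∞ Θ) (c : N)
    {y : ℝ²} (hy : y ∈ (extChartAt (𝓡 2) c).target) (s a : ℝ) (v : ℝ²) :
    mfderiv 𝓘(ℝ, ℝ × ℝ²) (𝓡 2) (chartFlow Θ c) (s, y) (a, v) =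
      mfderiv (𝓘(ℝ, ℝ).prod (𝓡 2)) (𝓡 2) Θ (s, (extChartAt (𝓡 2) c).symm y)
        (a, mfderiv 𝓘(ℝ, ℝ²) (𝓡 2) (extChartAt (𝓡 2) c).symm y v) := by
  have hfst : HasMFDerivAt 𝓘(ℝ, ℝ × ℝ²) 𝓘(ℝ, ℝ) (Prod.fst : ℝ × ℝ² → ℝ) (s, y)
      (ContinuousLinearMap.fst ℝ ℝ ℝ²) := hasFDerivAt_fst.hasMFDerivAt
  have hsnd : HasMFDerivAt 𝓘(ℝ, ℝ × ℝ²) 𝓘(ℝ, ℝ²) (Prod.snd : ℝ × ℝ² → ℝ²) (s, y)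
      (ContinuousLinearMap.snd ℝ ℝ ℝ²) := hasFDerivAt_snd.hasMFDerivAt
  have hsymm : MDifferentiableAt 𝓘(ℝ, ℝ²) (𝓡 2) (extChartAt (𝓡 2) c).symm y :=
    ((contMDiffOn_extChartAt_symm (n := ∞) c).contMDiffAt
      ((isOpen_extChartAt_target c).mem_nhds hy)).mdifferentiableAt (by simp)
  have hflow : MDifferentiableAt (𝓘(ℝ, ℝ).prod (𝓡 2)) (𝓡 2) Θ (s, (extChartAt (𝓡 2) c).symm y) :=
    hΘ.mdifferentiable (by simp) _
  exact DFunLike.congr_fun (hflow.hasMFDerivAt.comp (s, y)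
    (hfst.prodMk (hsymm.hasMFDerivAt.comp (s, y) hsnd))).mfderiv (a, v)

lemma chartRep_flowIntegrand (hΘ : ContMDiff (𝓘(ℝ, ℝ).prod (𝓡 2)) (𝓡 2) ∞ Θ)
    (α : RawForm N (k + 1)) (c : N) {y : ℝ²} (hy : y ∈ (extChartAt (𝓡 2) c).target) (s : ℝ) :
    RawForm.chartRep (fun q => flowIntegrand Θ α q s) c y =
      fiberContraction (α.pullback (chartFlow Θ c) (s, y)) := by
  ext v
  rw [fiberContraction_apply, RawForm.pullback_apply]
  change α (Θ (s, (extChartAt (𝓡 2) c).symm y)) _ = α (Θ (s, (extChartAt (𝓡 2) c).symm y)) _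
  congr 1
  funext i
  refine Fin.cases ?_ (fun i => ?_) i
  · have hzero : mfderiv 𝓘(ℝ, ℝ²) (𝓡 2) (extChartAt (𝓡 2) c).symm y 0 = 0 := map_zero _
    refine Eq.trans ?_ (mfderiv_chartFlow hΘ c hy s 1 0).symm
    exact (congrArg (fun w : ℝ² => mfderiv (𝓘(ℝ, ℝ).prod (𝓡 2)) (𝓡 2) Θ
      (s, (extChartAt (𝓡 2) c).symm y) ((1 : ℝ), w)) hzero).symm
  · exact (mfderiv_chartFlow hΘ c hy s 0 (v i)).symm

lemma continuous_flowIntegrand (hΘ : ContMDiff (𝓘(ℝ, ℝ).prod (𝓡 2)) (𝓡 2) ∞ Θ)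
    {α : RawForm N (k + 1)} (hα : α.IsSmooth) (p : N) :
    Continuous (flowIntegrand Θ α p) := by
  have hpullback : Continuous fun s : ℝ =>
      α.pullback (chartFlow Θ p) (s, extChartAt (𝓡 2) p p) :=
    (hα.contDiffOn_pullback_chartFlow hΘ p).continuousOn.comp_continuous
      (f := fun s : ℝ => (s, extChartAt (𝓡 2) p p)) (by fun_prop)
      fun s => ⟨mem_univ s, mem_extChartAt_target p⟩
  have hchart (s : ℝ) : flowIntegrand Θ α p s =
      (fiberContraction
        (α.pullback (chartFlow Θ p) (s, extChartAt (𝓡 2) p p))).compContinuousLinearMap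
        (show ℝ² →L[ℝ] ℝ² from mfderiv (𝓡 2) 𝓘(ℝ, ℝ²) (extChartAt (𝓡 2) p) p) := by
    rw [← chartRep_flowIntegrand hΘ α p (mem_extChartAt_target p) s]
    exact (RawForm.chartRep_comp_mfderiv (fun q => flowIntegrand Θ α q s) p
      (mem_extChartAt_source p)).symm
  simp only [funext hchart]
  exact (ContinuousAlternatingMap.compContinuousLinearMapCLM _).continuous.comp
    ((fiberContraction (E := ℝ²) (F := ℝ) (k := k)).continuous.comp hpullback)

section Integrability

variable (hΘ : ContMDiff (𝓘(ℝ, ℝ).prod (𝓡 2)) (𝓡 2) ∞ Θ) (hp : IsProperFlow Θ)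
  {α β : RawForm N (k + 1)}
include hΘ hp

lemma integrable_flowIntegrand (hα : α.IsSmooth) (hαc : IsCompact α.supp) (p : N) :
    Integrable (flowIntegrand Θ α p) := by
  obtain ⟨R, -, hbound⟩ := hp.exists_bound hαc p
  refine (continuous_flowIntegrand hΘ hα p).integrable_of_hasCompactSupport <|
    HasCompactSupport.intro (isCompact_Icc (a := -R) (b := R)) fun s hs =>
      flowIntegrand_eq_zero fun hmem => hs (abs_le.1 (hbound.self_of_nhds s hmem).le)

lemma pastIntegral_add (hα : α.IsSmooth) (hαc : IsCompact α.supp) (hβ : β.IsSmooth)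
    (hβc : IsCompact β.supp) :
    pastIntegral Θ (α + β) = pastIntegral Θ α + pastIntegral Θ β :=
  funext fun p => integral_add (integrable_flowIntegrand hΘ hp hα hαc p).integrableOn
    (integrable_flowIntegrand hΘ hp hβ hβc p).integrableOn

lemma pastIntegral_apply (hα : α.IsSmooth) (hαc : IsCompact α.supp) (p : N)
    (v : Fin k → TangentSpace (𝓡 2) p) : pastIntegral Θ α p v = forwardG Θ α p v :=
  ((ContinuousAlternatingMap.apply ℝ ℝ² ℝ (show Fin k → ℝ² from v)).integral_comp_comm
    (integrable_flowIntegrand hΘ hp hα hαc p).integrableOn).symm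

end Integrability

lemma chartRep_pastIntegral (hΘ : ContMDiff (𝓘(ℝ, ℝ).prod (𝓡 2)) (𝓡 2) ∞ Θ)
    {α : RawForm N (k + 1)} (hα : α.IsSmooth) {c : N} {y : ℝ²}
    (hy : y ∈ (extChartAt (𝓡 2) c).target) {R : ℝ} (hR : 0 < R)
    (hbound : ∀ s, Θ (s, (extChartAt (𝓡 2) c).symm y) ∈ α.supp → |s| < R) :
    (pastIntegral Θ α).chartRep c y =
      ∫ s in (-R)..0, fiberContraction (α.pullback (chartFlow Θ c) (s, y)) := by
  have hpullback : (pastIntegral Θ α).chartRep c y =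
      ContinuousAlternatingMap.compContinuousLinearMapCLM
        (show ℝ² →L[ℝ] ℝ² from mfderiv 𝓘(ℝ, ℝ²) (𝓡 2) (extChartAt (𝓡 2) c).symm y)
        (∫ s in (-R)..0, flowIntegrand Θ α ((extChartAt (𝓡 2) c).symm y) s) :=
    congrArg (ContinuousAlternatingMap.compContinuousLinearMap · _)
      (pastIntegral_eq_intervalIntegral hR hbound)
  rw [hpullback, ← ContinuousLinearMap.intervalIntegral_comp_comm
    (E := ℝ² [⋀^Fin k]→L[ℝ] ℝ) (F := ℝ² [⋀^Fin k]→L[ℝ] ℝ) _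
    ((continuous_flowIntegrand hΘ hα _).intervalIntegrable _ _)]
  exact intervalIntegral.integral_congr fun s _ => chartRep_flowIntegrand hΘ α c hy s

lemma RawForm.IsSmooth.pastIntegral (hΘ : ContMDiff (𝓘(ℝ, ℝ).prod (𝓡 2)) (𝓡 2) ∞ Θ)
    (hp : IsProperFlow Θ) {α : RawForm N (k + 1)} (hα : α.IsSmooth) (hαc : IsCompact α.supp) :
    (pastIntegral Θ α).IsSmooth := by
  intro c y hy
  obtain ⟨R, hR, hbound⟩ := hp.exists_chart_bound hαc c hy
  have hintegral := contDiffOn_parametric_intervalIntegral (isOpen_extChartAt_target c)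
    ((fiberContraction (E := ℝ²) (F := ℝ) (k := k)).contDiff.comp_contDiffOn
      (hα.contDiffOn_pullback_chartFlow hΘ c)) (-R) 0
  refine ((hintegral.contDiffAt ((isOpen_extChartAt_target c).mem_nhds hy)).congr_of_eventuallyEq
    ?_).contDiffWithinAt
  filter_upwards [hbound] with z hz using chartRep_pastIntegral hΘ hα hz.1 hR hz.2

lemma fiberRestriction_pullback_chartFlow_zero (hΘ : IsFlow Θ) (α : RawForm N k) (c : N)
    {y : ℝ²} (hy : y ∈ (extChartAt (𝓡 2) c).target) :
    fiberRestriction (α.pullback (chartFlow Θ c) (0, y)) = α.chartRep c y := by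
  have hslice : HasFDerivAt (fun z : ℝ² => ((0 : ℝ), z)) (.inr ℝ ℝ ℝ²) y :=
    hasFDerivAt_prodMk_right 0 y
  have hdiff : MDifferentiableAt 𝓘(ℝ, ℝ × ℝ²) (𝓡 2) (chartFlow Θ c) ((0 : ℝ), y) :=
    ((contMDiffOn_chartFlow hΘ.contMDiff c).contMDiffAt
      ((isOpen_univ_prod_extChartAt_target c).mem_nhds ⟨mem_univ 0, hy⟩)).mdifferentiableAt
        (by simp)
  have hzero : (extChartAt (𝓡 2) c).symm = chartFlow Θ c ∘ fun z : ℝ² => ((0 : ℝ), z) :=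
    funext fun z => (hΘ.zero _).symm
  rw [RawForm.chartRep_eq_pullback, hzero,
    RawForm.pullback_comp α hdiff hslice.differentiableAt, hslice.fderiv]
  rfl

section Homotopy

variable (hΘ : IsFlow Θ) {c : N} {y : ℝ²} (hy : y ∈ (extChartAt (𝓡 2) c).target) {R : ℝ}
  (hR : 0 < R) {α : RawForm N k}
  (hbound : ∀ s, Θ (s, (extChartAt (𝓡 2) c).symm y) ∈ α.supp → |s| < R)
include hΘ hy hR hbound

lemma fiberRestriction_pullback_chartFlow_sub :
    fiberRestriction (α.pullback (chartFlow Θ c) (0, y)) -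
      fiberRestriction (α.pullback (chartFlow Θ c) (-R, y)) = α.chartRep c y := by
  have hpast : α.pullback (chartFlow Θ c) (-R, y) = 0 :=
    RawForm.pullback_eq_zero <| RawForm.eq_zero_of_notMem_supp fun hmem => by
      simpa only [abs_neg, abs_of_pos hR, lt_self_iff_false] using hbound (-R) hmem
  rw [fiberRestriction_pullback_chartFlow_zero hΘ α c hy, hpast, map_zero, sub_zero]

lemma chartRep_pastIntegral_extd (hα : α.IsSmooth) :
    (pastIntegral Θ α.extd).chartRep c y =
      ∫ s in (-R)..0, fiberContraction (extDeriv (α.pullback (chartFlow Θ c)) (s, y)) := by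
  rw [chartRep_pastIntegral hΘ.contMDiff hα.extd hy hR
    fun s hs => hbound s (α.supp_extd_subset hs)]
  exact intervalIntegral.integral_congr fun s _ => congrArg _
    (hα.extDeriv_pullback (isOpen_univ_prod_extChartAt_target c)
      (contMDiffOn_chartFlow hΘ.contMDiff c) ⟨mem_univ s, hy⟩).symm

end Homotopy

lemma extd_pastIntegral_add (hΘ : IsFlow Θ) (hp : IsProperFlow Θ) {α : RawForm N (k + 1)}
    (hα : α.IsSmooth) (hαc : IsCompact α.supp) :
    (pastIntegral Θ α).extd + pastIntegral Θ α.extd = α := by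
  refine RawForm.ext_chartRep fun c => ?_
  have hy := mem_extChartAt_target (I := 𝓡 2) c
  obtain ⟨R, hR, hbound⟩ := hp.exists_chart_bound hαc c hy
  have hintegral : (pastIntegral Θ α).chartRep c =ᶠ[𝓝 (extChartAt (𝓡 2) c c)] fun z =>
      ∫ s in (-R)..0, fiberContraction (α.pullback (chartFlow Θ c) (s, z)) := by
    filter_upwards [hbound] with z hz using chartRep_pastIntegral hΘ.contMDiff hα hz.1 hR hz.2
  have hbound' := hbound.self_of_nhds.2
  rw [RawForm.chartRep_add, Pi.add_apply,
    RawForm.chartRep_extd (hα.pastIntegral hΘ.contMDiff hp hαc) c hy, hintegral.extDeriv_eq,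
    chartRep_pastIntegral_extd hΘ hy hR hbound' hα,
    extDeriv_intervalIntegral_fiberContraction_add (isOpen_extChartAt_target c)
      ((hα.contDiffOn_pullback_chartFlow hΘ.contMDiff c).of_le (by simp)) (-R) 0 hy,
    fiberRestriction_pullback_chartFlow_sub hΘ hy hR hbound']

lemma pastIntegral_extd_zero (hΘ : IsFlow Θ) (hp : IsProperFlow Θ) {α : RawForm N 0}
    (hα : α.IsSmooth) (hαc : IsCompact α.supp) : pastIntegral Θ α.extd = α := by
  refine RawForm.ext_chartRep fun c => ?_
  have hy := mem_extChartAt_target (I := 𝓡 2) c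
  obtain ⟨R, hR, hbound⟩ := hp.exists_chart_bound hαc c hy
  have hbound' := hbound.self_of_nhds.2
  rw [chartRep_pastIntegral_extd hΘ hy hR hbound' hα,
    intervalIntegral_fiberContraction_extDeriv_zero (isOpen_extChartAt_target c)
      ((hα.contDiffOn_pullback_chartFlow hΘ.contMDiff c).of_le (by simp)) (-R) 0 hy,
    fiberRestriction_pullback_chartFlow_sub hΘ hy hR hbound']

end FlowIntegral

/-! ### Null directions and self-duality -/

section TwoForm

variable {V : Type*} [AddCommGroup V] [Module ℝ V] [TopologicalSpace V] (b : V [⋀^Fin 2]→L[ℝ] ℝ)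

lemma twoForm_self (x : V) : b ![x, x] = 0 :=
  b.map_eq_zero_of_eq ![x, x] (i := 0) (j := 1) rfl (by decide)

lemma twoForm_add_left (x y z : V) : b ![x + y, z] = b ![x, z] + b ![y, z] :=
  b.toMultilinearMap.cons_add ![z] x y

lemma twoForm_smul_left (c : ℝ) (x y : V) : b ![c • x, y] = c * b ![x, y] :=
  b.toMultilinearMap.cons_smul ![y] c x

lemma twoForm_swap (x y : V) : b ![y, x] = -b ![x, y] := by
  have hcomp : ![x, y] ∘ Equiv.swap (0 : Fin 2) 1 = ![y, x] := by
    funext i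
    fin_cases i <;> simp
  exact hcomp ▸ b.toAlternatingMap.map_swap ![x, y] (i := 0) (j := 1) (by decide)

lemma twoForm_smul_right (c : ℝ) (x y : V) : b ![x, c • y] = c * b ![x, y] := by
  rw [twoForm_swap, twoForm_smul_left, twoForm_swap b x y, mul_neg, neg_neg]

lemma twoForm_linear_combination (c d c' d' : ℝ) (x y : V) :
    b ![c • x + d • y, c' • x + d' • y] = (c * d' - d * c') * b ![x, y] := by
  rw [twoForm_add_left, twoForm_smul_left, twoForm_smul_left, twoForm_swap b _ x,
    twoForm_swap b _ y]
  simp only [twoForm_add_left, twoForm_smul_left, twoForm_self, twoForm_swap b x y]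
  ring

end TwoForm

/-- The sign `ε` for which the covectors with `* β = ε β` are those that vanish on the null vectors
pointing in a given direction. -/
def NullDirection.sign : NullDirection → ℝ
  | .ne => 1
  | .nw => -1
  | .sw => 1
  | .se => -1

/-- The direction of `-v` for a null vector `v` pointing in a given direction. -/
def NullDirection.opposite : NullDirection → NullDirection
  | .ne => .sw
  | .nw => .se
  | .sw => .ne
  | .se => .nw

lemma NullDirection.sign_mul_self (dir : NullDirection) : dir.sign * dir.sign = 1 := by
  cases dir <;> norm_num [sign]

lemma NullDirection.sign_opposite (dir : NullDirection) : dir.opposite.sign = dir.sign := by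
  cases dir <;> rfl

section Duality

variable {N : Type u} [TopologicalSpace N] [ChartedSpace (EuclideanSpace ℝ (Fin 2)) N]

lemma covector_apply {p : N} (α : TangentSpace (𝓡 2) p [⋀^Fin 1]→L[ℝ] ℝ)
    (v : TangentSpace (𝓡 2) p) : covector α v = α fun _ => v := by
  change α (Function.update 0 0 v) = _
  congr 1
  funext i
  rw [Subsingleton.elim i 0, Function.update_self]

variable [IsManifold (𝓡 2) ∞ N]

namespace LorentzStructure

variable (S : LorentzStructure N) {dir : NullDirection} {p : N}

lemma frame_spec (p : N) : S.g p (S.frame p 0) (S.frame p 0) = -1 ∧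
    S.g p (S.frame p 1) (S.frame p 1) = 1 ∧ S.g p (S.frame p 0) (S.frame p 1) = 0 :=
  (S.g_signature p).choose_spec

lemma g_linear_combination_frame (c d : ℝ) :
    S.g p (c • S.frame p 0 + d • S.frame p 1) (S.frame p 0) = -c ∧
      S.g p (c • S.frame p 0 + d • S.frame p 1) (S.frame p 1) = d := by
  obtain ⟨h00, h11, h01⟩ := S.frame_spec p
  have h10 : S.g p (S.frame p 1) (S.frame p 0) = 0 := by rw [S.g_symm, h01]
  constructor <;> simp [h00, h01, h10, h11]

lemma linearIndependent_frame (p : N) : LinearIndependent ℝ (S.frame p) := by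
  rw [Fintype.linearIndependent_iff]
  intro c hc
  rw [Fin.sum_univ_two] at hc
  have hcoord := S.g_linear_combination_frame (p := p) (c 0) (c 1)
  rw [hc, map_zero] at hcoord
  exact Fin.forall_fin_two.2 ⟨neg_eq_zero.1 hcoord.1.symm, hcoord.2.symm⟩

lemma eq_linear_combination_frame (v : TangentSpace (𝓡 2) p) :
    v = (-S.g p v (S.frame p 0)) • S.frame p 0 + S.g p v (S.frame p 1) • S.frame p 1 := by
  have hcard : Fintype.card (Fin 2) = Module.finrank ℝ (TangentSpace (𝓡 2) p) :=
    (finrank_euclideanSpace (𝕜 := ℝ) (ι := Fin 2)).symm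
  let b := basisOfLinearIndependentOfCardEqFinrank (S.linearIndependent_frame p) hcard
  have hsum := b.sum_repr v
  simp only [b, Fin.sum_univ_two, coe_basisOfLinearIndependentOfCardEqFinrank] at hsum
  have hcoord := S.g_linear_combination_frame (p := p) (b.repr v 0) (b.repr v 1)
  rw [hsum] at hcoord
  rw [hcoord.1, hcoord.2, neg_neg, hsum]

lemma g_eq_frame_coords (x y : TangentSpace (𝓡 2) p) :
    S.g p x y = -(S.g p x (S.frame p 0) * S.g p y (S.frame p 0)) +
      S.g p x (S.frame p 1) * S.g p y (S.frame p 1) := by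
  conv_lhs => rw [S.eq_linear_combination_frame y]
  simp only [map_add, map_smul, smul_eq_mul]
  ring

lemma twoForm_eq_frame_coords (b : TangentSpace (𝓡 2) p [⋀^Fin 2]→L[ℝ] ℝ)
    (x y : TangentSpace (𝓡 2) p) :
    b ![x, y] = (S.g p x (S.frame p 1) * S.g p y (S.frame p 0) -
      S.g p x (S.frame p 0) * S.g p y (S.frame p 1)) * b (S.frame p) := by
  have hframe : ![S.frame p 0, S.frame p 1] = S.frame p := List.ofFn_injective rfl
  conv_lhs => rw [S.eq_linear_combination_frame x, S.eq_linear_combination_frame y]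
  rw [twoForm_linear_combination, hframe]
  ring

lemma orient_frame_ne_zero (p : N) : S.orient p (S.frame p) ≠ 0 := by
  refine fun h => S.orient_ne_zero p (ContinuousAlternatingMap.ext fun w => ?_)
  rw [show w = ![w 0, w 1] from List.ofFn_injective rfl, S.twoForm_eq_frame_coords, h, mul_zero]
  rfl

lemma vol_apply (w : Fin 2 → TangentSpace (𝓡 2) p) :
    S.vol p w = |S.orient p (S.frame p)|⁻¹ * S.orient p w := rfl

lemma vol_frame_sq (p : N) : S.vol p (S.frame p) ^ 2 = 1 := by
  rw [vol_apply, mul_pow, inv_pow, sq_abs,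
    inv_mul_cancel₀ (pow_ne_zero 2 (S.orient_frame_ne_zero p))]

lemma vol_mul_vol (x y x' y' : TangentSpace (𝓡 2) p) :
    S.vol p ![x, y] * S.vol p ![x', y'] = S.g p x y' * S.g p y x' - S.g p x x' * S.g p y y' := by
  rw [S.twoForm_eq_frame_coords _ x, S.twoForm_eq_frame_coords _ x', S.g_eq_frame_coords x y',
    S.g_eq_frame_coords y x', S.g_eq_frame_coords x x', S.g_eq_frame_coords y y']
  linear_combination (S.g p x (S.frame p 1) * S.g p y (S.frame p 0) -
    S.g p x (S.frame p 0) * S.g p y (S.frame p 1)) *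
    (S.g p x' (S.frame p 1) * S.g p y' (S.frame p 0) -
      S.g p x' (S.frame p 0) * S.g p y' (S.frame p 1)) * S.vol_frame_sq p

variable {S} {n : TangentSpace (𝓡 2) p}

lemma IsPointing.g_time_ne_zero (hn : S.IsPointing dir p n) : S.g p (S.time p) n ≠ 0 := by
  have hdir := hn.2.2
  cases dir
  exacts [hdir.1.ne, hdir.1.ne, hdir.1.ne', hdir.1.ne']

lemma IsPointing.sign_mul_vol_time_mul_g_time_neg (hn : S.IsPointing dir p n) :
    dir.sign * S.vol p ![S.time p, n] * S.g p (S.time p) n < 0 := by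
  have hscale : 0 < |S.orient p (S.frame p)|⁻¹ :=
    inv_pos.2 (abs_pos.2 (S.orient_frame_ne_zero p))
  have horient : dir.sign * (S.orient p ![S.time p, n] * S.g p (S.time p) n) < 0 := by
    have hdir := hn.2.2
    cases dir <;> simp only [NullDirection.sign, one_mul, neg_mul, neg_lt_zero]
    · exact mul_neg_of_pos_of_neg hdir.2 hdir.1
    · exact mul_pos_of_neg_of_neg hdir.2 hdir.1
    · exact mul_neg_of_neg_of_pos hdir.2 hdir.1
    · exact mul_pos hdir.2 hdir.1
  rw [vol_apply]
  linarith [mul_neg_of_pos_of_neg hscale horient]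

lemma IsPointing.vol_time (hn : S.IsPointing dir p n) :
    S.vol p ![S.time p, n] = -dir.sign * S.g p (S.time p) n := by
  have hsquares : (dir.sign * S.vol p ![S.time p, n]) ^ 2 = S.g p (S.time p) n ^ 2 := by
    have h := S.vol_mul_vol (S.time p) n (S.time p) n
    rw [hn.2.1, S.g_symm p n] at h
    linear_combination h + S.vol p ![S.time p, n] ^ 2 * dir.sign_mul_self
  rcases sq_eq_sq_iff_eq_or_eq_neg.1 hsquares with h | h
  · nlinarith [hn.sign_mul_vol_time_mul_g_time_neg, sq_nonneg (S.g p (S.time p) n)]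
  · linear_combination dir.sign * h - S.vol p ![S.time p, n] * dir.sign_mul_self

lemma IsPointing.vol_right (hn : S.IsPointing dir p n) (x : TangentSpace (𝓡 2) p) :
    S.vol p ![x, n] = -dir.sign * S.g p x n := by
  have h := S.vol_mul_vol x n (S.time p) n
  rw [hn.vol_time, hn.2.1, S.g_symm p n] at h
  refine mul_right_cancel₀ hn.g_time_ne_zero ?_
  linear_combination -dir.sign * h - S.vol p ![x, n] * S.g p (S.time p) n * dir.sign_mul_self

lemma hodgeStar_eq_sign_smul_iff (hn : S.IsPointing dir p n)
    (β : TangentSpace (𝓡 2) p →L[ℝ] ℝ) : S.hodgeStar p β = dir.sign • β ↔ β n = 0 := by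
  obtain ⟨u, rfl⟩ := (S.flat p).surjective β
  change _ ↔ S.g p u n = 0
  have hstar : ∀ v, S.hodgeStar p (S.flat p u) v = S.vol p ![u, v] := fun v => by
    rw [hodgeStar_apply, LinearEquiv.symm_apply_apply]
  constructor
  · intro h
    have hstar_n : S.vol p ![u, n] = dir.sign * S.g p u n :=
      (hstar n).symm.trans (DFunLike.congr_fun h n)
    linear_combination -dir.sign / 2 * hstar_n + dir.sign / 2 * hn.vol_right u -
      S.g p u n * dir.sign_mul_self
  · intro h
    ext v
    change _ = dir.sign * S.g p u v
    rw [hstar]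
    have hperp : S.vol p ![u, n] = 0 := by rw [hn.vol_right, h, mul_zero]
    have hgram := S.vol_mul_vol u v (S.time p) n
    have hgram' := S.vol_mul_vol u n (S.time p) v
    rw [hn.vol_time, h] at hgram
    rw [hperp, S.g_symm p n, S.g_symm p n] at hgram'
    refine mul_right_cancel₀ hn.g_time_ne_zero ?_
    linear_combination -dir.sign * hgram + dir.sign * hgram' -
      S.vol p ![u, v] * S.g p (S.time p) n * dir.sign_mul_self

lemma mem_dualForms_iff {n : ∀ p : N, TangentSpace (𝓡 2) p}
    (hn : ∀ p, S.IsPointing dir p (n p)) {α : RawForm N 1} :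
    α ∈ S.dualForms dir.sign ↔ α.IsSmooth ∧ ∀ p, α p (fun _ => n p) = 0 := by
  refine and_congr_right fun _ => forall_congr' fun p => ?_
  rw [hodgeStar_eq_sign_smul_iff (hn p), covector_apply]

lemma IsPointing.pos_smul (hn : S.IsPointing dir p n) {a : ℝ} (ha : 0 < a) :
    S.IsPointing dir p (a • n) := by
  refine ⟨smul_ne_zero ha.ne' hn.1, by simp [hn.2.1], ?_⟩
  have hdir := hn.2.2
  cases dir <;> simpa [twoForm_smul_right, ha, mul_neg_iff, ha.not_gt] using hdir

lemma IsPointing.neg (hn : S.IsPointing dir p n) : S.IsPointing dir.opposite p (-n) := by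
  have horient : S.orient p ![S.time p, -n] = -S.orient p ![S.time p, n] := by
    rw [← neg_one_smul ℝ n, twoForm_smul_right, neg_one_mul]
  refine ⟨neg_ne_zero.2 hn.1, by simp [hn.2.1], ?_⟩
  have hdir := hn.2.2
  cases dir <;> simpa [NullDirection.opposite, horient] using hdir

end LorentzStructure

end Duality

/-! ### Flows along null directions -/

section Reversal

variable {N : Type u} [TopologicalSpace N] {Θ : ℝ × N → N}

/-- The flow of the opposite vector field: its forward operator is the backward operator of `Θ`. -/
def reversedFlow (Θ : ℝ × N → N) (x : ℝ × N) : N := Θ (-x.1, x.2)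

lemma IsProperFlow.reversed (hp : IsProperFlow Θ) : IsProperFlow (reversedFlow Θ) :=
  IsProperMap.comp hp ((Homeomorph.neg ℝ).prodCongr (Homeomorph.refl N)).isProperMap

variable [ChartedSpace ℝ² N]

lemma IsFlow.reversed (hΘ : IsFlow Θ) : IsFlow (reversedFlow Θ) where
  contMDiff := hΘ.contMDiff.comp (((contDiff_neg.contMDiff).comp contMDiff_fst).prodMk
    contMDiff_snd)
  zero p := by rw [reversedFlow, neg_zero, hΘ.zero]
  add s t p := by simp only [reversedFlow, neg_add, hΘ.add]

lemma IsFlow.hasMFDerivAt_comp_prodMk {E H M : Type*} [NormedAddCommGroup E] [NormedSpace ℝ E]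
    [TopologicalSpace H] {I : ModelWithCorners ℝ E H} [TopologicalSpace M] [ChartedSpace H M]
    (hΘ : IsFlow Θ) {σ : M → ℝ} {γ : M → N} {x : M} {σ' : TangentSpace I x →L[ℝ] ℝ}
    {γ' : TangentSpace I x →L[ℝ] TangentSpace (𝓡 2) (γ x)}
    (hσ : HasMFDerivAt I 𝓘(ℝ, ℝ) σ x σ') (hγ : HasMFDerivAt I (𝓡 2) γ x γ') :
    HasMFDerivAt I (𝓡 2) (fun y => Θ (σ y, γ y)) x
      ((mfderiv (𝓘(ℝ, ℝ).prod (𝓡 2)) (𝓡 2) Θ (σ x, γ x)).comp (σ'.prod γ')) :=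
  (hΘ.contMDiff.mdifferentiable (by simp) _).hasMFDerivAt.comp x (hσ.prodMk hγ)

lemma mfderiv_reversedFlow (hΘ : IsFlow Θ) (s : ℝ) (p : N) (a : ℝ) (v : ℝ²) :
    mfderiv (𝓘(ℝ, ℝ).prod (𝓡 2)) (𝓡 2) (reversedFlow Θ) (s, p) (a, v) =
      mfderiv (𝓘(ℝ, ℝ).prod (𝓡 2)) (𝓡 2) Θ (-s, p) (-a, v) := by
  have hneg : HasMFDerivAt 𝓘(ℝ, ℝ) 𝓘(ℝ, ℝ) (fun s : ℝ => -s) s (-ContinuousLinearMap.id ℝ ℝ) :=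
    (hasFDerivAt_id s).neg.hasMFDerivAt
  have hrev := hΘ.hasMFDerivAt_comp_prodMk (hneg.comp (s, p) (hasMFDerivAt_fst (s, p)))
    (hasMFDerivAt_snd (I := 𝓘(ℝ, ℝ)) (I' := 𝓡 2) (s, p))
  exact DFunLike.congr_fun hrev.mfderiv (a, v)

lemma flowIntegrand_reversedFlow (hΘ : IsFlow Θ) {k : ℕ} (α : RawForm N (k + 1)) (p : N) (s : ℝ)
    (v : Fin k → ℝ²) :
    flowIntegrand (reversedFlow Θ) α p s v = -flowIntegrand Θ α p (-s) v := by
  let D : ℝ × ℝ² →L[ℝ] ℝ² := mfderiv (𝓘(ℝ, ℝ).prod (𝓡 2)) (𝓡 2) Θ (-s, p)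
  let A : ℝ² [⋀^Fin (k + 1)]→L[ℝ] ℝ := α (Θ (-s, p))
  have hforward : flowIntegrand Θ α p (-s) v =
      A (Fin.cons (D (1, 0)) fun i => D (0, v i)) :=
    congrArg A (funext fun i => Fin.cases rfl (fun _ => rfl) i)
  have hbackward : flowIntegrand (reversedFlow Θ) α p s v =
      A (Fin.cons ((-1 : ℝ) • D (1, 0)) fun i => D (0, v i)) := by
    refine congrArg A (funext fun i => Fin.cases ?_ (fun j => ?_) i)
    · refine (mfderiv_reversedFlow hΘ s p 1 0).trans ?_
      change D (-1, 0) = (-1 : ℝ) • D (1, 0)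
      rw [← map_smul, Prod.smul_mk, smul_zero, smul_eq_mul, mul_one]
    · refine (mfderiv_reversedFlow hΘ s p 0 (v j)).trans ?_
      change D (-0, v j) = D (0, v j)
      rw [neg_zero]
  rw [hforward, hbackward]
  exact (A.toMultilinearMap.cons_smul _ _ _).trans (neg_one_smul ℝ _)

lemma forwardG_reversedFlow (hΘ : IsFlow Θ) {k : ℕ} (α : RawForm N (k + 1)) (p : N)
    (v : Fin k → TangentSpace (𝓡 2) p) :
    forwardG (reversedFlow Θ) α p v = backwardG Θ α p v :=
  calc forwardG (reversedFlow Θ) α p v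
      = ∫ s in Iic (0 : ℝ), -flowIntegrand Θ α p (-s) v :=
        integral_congr_ae (.of_forall fun s => flowIntegrand_reversedFlow hΘ α p s v)
    _ = -∫ s in Ici (0 : ℝ), flowIntegrand Θ α p s v := by
        rw [integral_neg, integral_comp_neg_Iic 0 fun s => flowIntegrand Θ α p s v, neg_zero,
          ← integral_Ici_eq_integral_Ioi]
    _ = backwardG Θ α p v := rfl

end Reversal

section Generator

variable {N : Type u} [TopologicalSpace N] [ChartedSpace ℝ² N] {Θ : ℝ × N → N}
  {n : ∀ p : N, TangentSpace (𝓡 2) p}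

lemma mfderiv_flow_time (hΘ : IsFlow Θ) (hn : ∀ p, IsMIntegralCurve (fun s => Θ (s, p)) n)
    (s : ℝ) (p : N) :
    mfderiv (𝓘(ℝ, ℝ).prod (𝓡 2)) (𝓡 2) Θ (s, p) ((1 : ℝ), (0 : ℝ²)) = n (Θ (s, p)) := by
  have horbit := hΘ.hasMFDerivAt_comp_prodMk (hasMFDerivAt_id (I := 𝓘(ℝ, ℝ)) s)
    (hasMFDerivAt_const p s)
  exact (DFunLike.congr_fun (hasMFDerivAt_unique horbit (hn p s)) (1 : ℝ)).trans
    (one_smul ℝ (show ℝ² from n (Θ (s, p))))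

lemma mfderiv_flow_generator_orbit (hΘ : IsFlow Θ)
    (hn : ∀ p, IsMIntegralCurve (fun s => Θ (s, p)) n) (s t : ℝ) (p : N) :
    mfderiv (𝓘(ℝ, ℝ).prod (𝓡 2)) (𝓡 2) Θ (s, Θ (t, p)) ((0 : ℝ), n (Θ (t, p))) =
      (n (Θ (s + t, p)) : ℝ²) := by
  have hone : ∀ w : ℝ², (1 : ℝ) • w = w := one_smul ℝ
  have hmoved := hΘ.hasMFDerivAt_comp_prodMk
    (hasMFDerivAt_const (I := 𝓘(ℝ, ℝ)) (I' := 𝓘(ℝ, ℝ)) s t) (hn p t)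
  have hshift : HasMFDerivAt 𝓘(ℝ, ℝ) 𝓘(ℝ, ℝ) (fun t : ℝ => s + t) t
      (ContinuousLinearMap.id ℝ ℝ) := ((hasFDerivAt_id t).const_add s).hasMFDerivAt
  have hshifted := ((hn p (s + t)).comp t hshift).congr_of_eventuallyEq
    (f₁ := fun t => Θ (s, Θ (t, p))) (.of_forall fun t => (hΘ.add s t p).symm)
  have hvelocity := DFunLike.congr_fun (hasMFDerivAt_unique hmoved hshifted) (1 : ℝ)
  refine Eq.trans ?_ (hvelocity.trans (hone _))
  exact (congrArg (fun w : ℝ² => mfderiv (𝓘(ℝ, ℝ).prod (𝓡 2)) (𝓡 2) Θ (s, Θ (t, p))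
    ((0 : ℝ), w)) (hone _)).symm

lemma mfderiv_flow_generator (hΘ : IsFlow Θ) (hn : ∀ p, IsMIntegralCurve (fun s => Θ (s, p)) n)
    (s : ℝ) (p : N) :
    mfderiv (𝓘(ℝ, ℝ).prod (𝓡 2)) (𝓡 2) Θ (s, p) ((0 : ℝ), n p) = n (Θ (s, p)) := by
  have h := mfderiv_flow_generator_orbit hΘ hn s 0 p
  rwa [add_zero, hΘ.zero] at h

lemma flowIntegrand_eq_generator (hΘ : IsFlow Θ)
    (hn : ∀ p, IsMIntegralCurve (fun s => Θ (s, p)) n) {k : ℕ} (α : RawForm N (k + 1)) (p : N)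
    (s : ℝ) (v : Fin k → ℝ²) :
    flowIntegrand Θ α p s v = α (Θ (s, p)) (Fin.cons (n (Θ (s, p))) fun i =>
      mfderiv (𝓘(ℝ, ℝ).prod (𝓡 2)) (𝓡 2) Θ (s, p) ((0 : ℝ), v i)) :=
  congrArg (α (Θ (s, p))) (funext fun i =>
    Fin.cases (mfderiv_flow_time hΘ hn s p) (fun _ => rfl) i)

lemma pastIntegral_eq_zero_of_generator (hΘ : IsFlow Θ)
    (hn : ∀ p, IsMIntegralCurve (fun s => Θ (s, p)) n) {α : RawForm N 1}
    (hα : ∀ p, α p (fun _ => n p) = 0) : pastIntegral Θ α = 0 := by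
  have hintegrand : ∀ p s, flowIntegrand Θ α p s = 0 := by
    intro p s
    ext v
    rw [flowIntegrand_eq_generator hΘ hn]
    refine (congrArg (α (Θ (s, p))) (funext fun i => ?_)).trans (hα (Θ (s, p)))
    exact Fin.cases rfl (fun j => j.elim0) i
  funext p
  exact (integral_congr_ae (.of_forall (hintegrand p))).trans (integral_zero _ _)

lemma pastIntegral_generator [IsManifold (𝓡 2) ∞ N] (hΘ : IsFlow Θ) (hp : IsProperFlow Θ)
    (hn : ∀ p, IsMIntegralCurve (fun s => Θ (s, p)) n) {α : RawForm N 2} (hα : α.IsSmooth)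
    (hαc : IsCompact α.supp) (p : N) : pastIntegral Θ α p (fun _ => n p) = 0 := by
  have hintegrand : ∀ s, flowIntegrand Θ α p s (fun _ => n p) = 0 := by
    intro s
    refine (flowIntegrand_eq_generator hΘ hn α p s _).trans ?_
    refine (α (Θ (s, p))).map_eq_zero_of_eq _ (i := 0) (j := 1) ?_ (by decide)
    exact (mfderiv_flow_generator hΘ hn s p).symm
  rw [pastIntegral_apply hΘ.contMDiff hp hα hαc]
  exact (integral_congr_ae (.of_forall hintegrand)).trans (integral_zero _ _)

end Generator

namespace LorentzStructure.IsChiralFlow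

variable {N : Type u} [TopologicalSpace N] [ChartedSpace ℝ² N] [IsManifold (𝓡 2) ∞ N]
  {S : LorentzStructure N} {dir : NullDirection} {Θ : ℝ × N → N}

lemma reversed (h : S.IsChiralFlow dir Θ) : S.IsChiralFlow dir.opposite (reversedFlow Θ) := by
  obtain ⟨hΘ, n, hsmooth, hpoint, hn⟩ := h
  refine ⟨hΘ.reversed, -n, hsmooth.neg_section, fun p => (hpoint p).neg, fun p => ?_⟩
  have horbit : (fun s => reversedFlow Θ (s, p)) = (fun s => Θ (s, p)) ∘ (· * (-1 : ℝ)) := by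
    funext s
    simp [reversedFlow]
  rw [horbit, ← neg_one_smul ℝ n]
  exact (hn p).comp_mul (-1)

lemma isPointingCurve (h : S.IsChiralFlow dir Θ) {a : ℝ} (ha : 0 < a) (p : N) :
    S.IsPointingCurve dir ((fun t => Θ (t, p)) ∘ (· * a)) := by
  obtain ⟨hΘ, n, -, hpoint, hn⟩ := h
  refine ⟨?_, fun t ht => ?_⟩
  · exact (hΘ.contMDiff.comp (ContMDiff.prodMk
      (contDiff_id.mul contDiff_const).contMDiff contMDiff_const)).contMDiffOn
  · have hderiv := ((hn p).comp_mul a t).hasMFDerivWithinAt (s := Icc (0 : ℝ) 1)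
    have hunique : UniqueMDiffWithinAt 𝓘(ℝ, ℝ) (Icc (0 : ℝ) 1) t :=
      (uniqueDiffOn_Icc zero_lt_one t ht).uniqueMDiffWithinAt
    rw [hderiv.mfderivWithin hunique]
    have hone : ∀ w : ℝ², (1 : ℝ) • w = w := one_smul ℝ
    exact (congrArg (S.IsPointing dir _) (hone _)).mpr ((hpoint _).pos_smul ha)

lemma flowFuture_subset_J (h : S.IsChiralFlow dir Θ) (K : Set N) :
    flowFuture Θ K ⊆ S.J dir K := by
  rintro q ⟨s, hs, hK⟩
  refine ⟨Θ (s, q), hK, ?_⟩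
  rcases hs.eq_or_lt with rfl | hs
  · exact Or.inl (h.1.zero q).symm
  · refine Or.inr ⟨_, h.isPointingCurve (neg_pos.2 hs) (Θ (s, q)), ?_, ?_⟩
    · simp [h.1.zero]
    · simp [← h.1.add, h.1.zero]

end LorentzStructure.IsChiralFlow

/-! ### Cochains of degree `-1` on complexes of forms -/

namespace DeRhamSubcomplex

variable {N : Type u} [TopologicalSpace N] [ChartedSpace ℝ² N]

lemma compact_carrier_le (A : DeRhamSubcomplex N) (k : ℕ) : A.compact.carrier k ≤ A.carrier k :=
  inf_le_left

variable [IsManifold (𝓡 2) ∞ N] {A B : DeRhamSubcomplex N}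

/-- The `k`-form underlying an element of `A[1]` of degree `k - 1`, as an element of `A`. -/
def component (A : DeRhamSubcomplex N) {p : ℤ} (x : A.shifted.X p) (k : ℕ)
    (hk : (k : ℤ) = p + 1) : A.carrier k :=
  (show A.degree (p + 1) from x) ⟨k, hk⟩

lemma coe_component {p : ℤ} (x : A.shifted.X p) (k : ℕ) (hk : (k : ℤ) = p + 1) :
    (A.component x k hk : RawForm N k) = A.form x k hk := rfl

lemma ext_component {p : ℤ} {x y : A.shifted.X p}
    (h : ∀ (k : ℕ) (hk : (k : ℤ) = p + 1), A.component x k hk = A.component y k hk) : x = y :=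
  funext (f := (show A.degree (p + 1) from x)) (g := (show A.degree (p + 1) from y))
    fun k => h k.1 k.2

lemma supp_eq_supp_form (A : DeRhamSubcomplex N) {p : ℤ} (x : A.shifted.X p) (k : ℕ)
    (hk : (k : ℤ) = p + 1) : A.supp x = (A.form x k hk).supp := by
  refine congrArg closure (Set.ext fun q => ⟨?_, fun h => ⟨k, hk, h⟩⟩)
  rintro ⟨k', hk', h⟩
  obtain rfl : k' = k := by lia
  exact h

lemma supp_eq_empty (A : DeRhamSubcomplex N) {p : ℤ} (hp : p + 1 < 0) (x : A.shifted.X p) :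
    A.supp x = ∅ := by
  refine (closure_empty_iff _).2 (Set.eq_empty_of_forall_notMem ?_)
  rintro r ⟨k, hk, -⟩
  lia

lemma toComplex_d_apply (A : DeRhamSubcomplex N) (m : ℤ) (x : A.degree m) :
    (show A.degree (m + 1) from (A.toComplex.d m (m + 1)).hom x) = A.dInt m x := by
  simp only [toComplex, CochainComplex.of_d]
  rfl

lemma shifted_d_apply (A : DeRhamSubcomplex N) (p : ℤ) (x : A.shifted.X p) :
    (show A.degree (p + 1 + 1) from (A.shifted.d p (p + 1)).hom x) =
      -A.dInt (p + 1) (show A.degree (p + 1) from x) := by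
  have hshift : A.shifted.d p (p + 1) = -A.toComplex.d (p + 1) (p + 1 + 1) := by
    rw [CochainComplex.shiftFunctor_obj_d']
    simp
  rw [← toComplex_d_apply, hshift]
  rfl

lemma component_d_succ {p q : ℤ} (h : p + 1 = q) (x : A.shifted.X p) (k : ℕ)
    (hk : ((k + 1 : ℕ) : ℤ) = q + 1) (hk' : (k : ℤ) = p + 1) :
    A.component ((A.shifted.d p q).hom x) (k + 1) hk = -A.d k (A.component x k hk') := by
  subst h
  exact congrFun (A.shifted_d_apply p x) ⟨k + 1, hk⟩

lemma component_d_zero {p q : ℤ} (h : p + 1 = q) (x : A.shifted.X p)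
    (hk : ((0 : ℕ) : ℤ) = q + 1) :
    A.component ((A.shifted.d p q).hom x) 0 hk = 0 := by
  subst h
  exact (congrFun (A.shifted_d_apply p x) ⟨0, hk⟩).trans (neg_zero (G := A.carrier 0))

/-- The cochain of degree `-1` on shifted complexes given by operators that lower the form
degree. -/
def loweringCochain (P : ∀ k, A.carrier (k + 1) →ₗ[ℝ] B.carrier k) :
    Cochain A.shifted B.shifted (-1) :=
  Cochain.mk fun p q h => ModuleCat.ofHom
    (show A.degree (p + 1) →ₗ[ℝ] B.degree (q + 1) from
      LinearMap.pi fun k => (P k.1).comp (LinearMap.proj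
        (R := ℝ) (φ := fun k : {k : ℕ // (k : ℤ) = p + 1} => A.carrier k)
        ⟨k.1 + 1, by grind⟩))

section LoweringCochain

variable (P : ∀ k, A.carrier (k + 1) →ₗ[ℝ] B.carrier k)

lemma component_loweringCochain {p q : ℤ} (h : p + -1 = q) (x : A.shifted.X p) (k : ℕ)
    (hk : (k : ℤ) = q + 1) (hk' : ((k + 1 : ℕ) : ℤ) = p + 1) :
    B.component (((loweringCochain P).v p q h).hom x) k hk = P k (A.component x (k + 1) hk') :=
  rfl

lemma component_loweringCochain_d {p q : ℤ} (h : p + 1 = q) (h' : q + -1 = p)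
    (x : A.shifted.X p) (k : ℕ) (hk : (k : ℤ) = p + 1) :
    B.component (((loweringCochain P).v q p h').hom ((A.shifted.d p q).hom x)) k hk =
      -P k (A.d k (A.component x k hk)) := by
  have hk' : ((k + 1 : ℕ) : ℤ) = q + 1 := by grind
  rw [component_loweringCochain P h' _ k hk hk', component_d_succ h x k hk' hk]
  exact map_neg (P k) _

lemma component_δ_loweringCochain (p : ℤ) (x : A.shifted.X p) (k : ℕ) (hk : (k : ℤ) = p + 1) :
    B.component (((δ (-1) 0 (loweringCochain P)).v p p (add_zero p)).hom x) k hk =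
      B.component ((B.shifted.d (p - 1) p).hom (((loweringCochain P).v p (p - 1) rfl).hom x)) k hk +
        -P k (A.d k (A.component x k hk)) := by
  rw [δ_v (-1) 0 (by norm_num) _ p p (add_zero p) (p - 1) (p + 1) rfl rfl,
    Int.negOnePow_zero, one_smul]
  exact congrArg (B.component ((B.shifted.d (p - 1) p).hom
    (((loweringCochain P).v p (p - 1) rfl).hom x)) k hk + ·)
    (component_loweringCochain_d P rfl (by lia) x k hk)

end LoweringCochain

lemma δ_loweringCochain (P : ∀ k, A.compact.carrier (k + 1) →ₗ[ℝ] A.carrier k)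
    (hzero : ∀ α, P 0 (A.compact.d 0 α) = -Submodule.inclusion (A.compact_carrier_le _) α)
    (hsucc : ∀ k α, A.d k (P k α) + P (k + 1) (A.compact.d (k + 1) α) =
      -Submodule.inclusion (A.compact_carrier_le _) α) :
    δ (-1) 0 (loweringCochain P) =
      Cochain.ofHom ((incl (A := A.compact) (B := A) fun _ => inf_le_left)⟦(1 : ℤ)⟧') := by
  refine Cochain.ext₀ _ _ fun p =>
    ModuleCat.hom_ext (LinearMap.ext fun x => ext_component fun k hk => ?_)
  have hincl : A.component (((Cochain.ofHom ((incl (A := A.compact) (B := A)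
      fun _ => inf_le_left)⟦(1 : ℤ)⟧')).v p p (add_zero p)).hom x) k hk =
      Submodule.inclusion (A.compact_carrier_le k) (A.compact.component x k hk) := by
    rw [Cochain.ofHom_v]
    rfl
  rw [component_δ_loweringCochain, hincl]
  match k, hk with
  | 0, hk =>
    rw [component_d_zero (by lia), hzero]
    exact (zero_add _).trans (neg_neg (G := A.carrier 0) _)
  | k + 1, hk =>
    have hk' : (k : ℤ) = p - 1 + 1 := by grind
    rw [component_d_succ (by lia) _ k hk hk',
      component_loweringCochain P (q := p - 1) rfl x k hk' hk]
    exact (neg_add (α := A.carrier (k + 1)) _ _).symm.trans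
      ((congrArg Neg.neg (hsucc k _)).trans (neg_neg (G := A.carrier (k + 1)) _))

section NegPastIntegral

variable {Θ : ℝ × N → N}

/-- The operators `α ↦ -∫_{s ≤ 0} Θ^* α` on a subcomplex of the de Rham complex that they
preserve. -/
def negPastIntegral (hΘ : IsFlow Θ) (hp : IsProperFlow Θ)
    (hA : ∀ k, ∀ α ∈ A.compact.carrier (k + 1), pastIntegral Θ α ∈ A.carrier k) (k : ℕ) :
    A.compact.carrier (k + 1) →ₗ[ℝ] A.carrier k where
  toFun α := ⟨-pastIntegral Θ α.1, neg_mem (hA k α.1 α.2)⟩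
  map_add' α β := Subtype.ext (by
    change -pastIntegral Θ (α.1 + β.1) = -pastIntegral Θ α.1 + -pastIntegral Θ β.1
    rw [pastIntegral_add hΘ.contMDiff hp (A.smooth α.2.1) α.2.2 (A.smooth β.2.1) β.2.2, neg_add])
  map_smul' a α := Subtype.ext (by
    change -pastIntegral Θ (a • α.1) = a • -pastIntegral Θ α.1
    rw [pastIntegral_smul, smul_neg])

variable (hΘ : IsFlow Θ) (hp : IsProperFlow Θ)
  (hA : ∀ k, ∀ α ∈ A.compact.carrier (k + 1), pastIntegral Θ α ∈ A.carrier k)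

lemma δ_loweringCochain_negPastIntegral :
    δ (-1) 0 (loweringCochain (negPastIntegral hΘ hp hA)) =
      Cochain.ofHom ((incl (A := A.compact) (B := A) fun _ => inf_le_left)⟦(1 : ℤ)⟧') := by
  refine δ_loweringCochain _ (fun α => Subtype.ext ?_) fun k α => Subtype.ext ?_
  · exact congrArg Neg.neg (pastIntegral_extd_zero hΘ hp (A.smooth α.2.1) α.2.2)
  · change (-pastIntegral Θ α.1).extd + -pastIntegral Θ α.1.extd = -α.1
    rw [RawForm.extd_neg, ← neg_add, extd_pastIntegral_add hΘ hp (A.smooth α.2.1) α.2.2]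

lemma supp_loweringCochain_negPastIntegral_subset {p q : ℤ} (h : p + -1 = q)
    (x : A.compact.shifted.X p) :
    A.supp (((loweringCochain (negPastIntegral hΘ hp hA)).v p q h).hom x) ⊆
      flowFuture Θ (A.compact.supp x) := by
  rcases lt_or_ge (q + 1) 0 with hq | hq
  · exact (A.supp_eq_empty hq _).trans_subset (empty_subset _)
  · obtain ⟨k, hk⟩ := Int.eq_ofNat_of_zero_le hq
    have hk' : ((k + 1 : ℕ) : ℤ) = p + 1 := by grind
    rw [A.supp_eq_supp_form _ k hk.symm, A.compact.supp_eq_supp_form x (k + 1) hk',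
      ← coe_component, component_loweringCochain _ h x k hk.symm hk']
    exact (RawForm.supp_neg _).trans_subset (supp_pastIntegral_subset hp hΘ.contMDiff.continuous
      (A.compact.component x (k + 1) hk').2.2)

lemma isGreensHomotopy_negPastIntegral {J : Set N → Set N} (hJ : ∀ K, flowFuture Θ K ⊆ J K) :
    IsGreensHomotopy A J (loweringCochain (negPastIntegral hΘ hp hA)) where
  boundary := δ_loweringCochain_negPastIntegral hΘ hp hA
  supp_subset _ _ h x :=
    (supp_loweringCochain_negPastIntegral_subset hΘ hp hA h x).trans (hJ _)

include hΘ hp in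
lemma pastIntegral_mem_deRham (k : ℕ) (α : RawForm N (k + 1))
    (hα : α ∈ (deRham N).compact.carrier (k + 1)) : pastIntegral Θ α ∈ (deRham N).carrier k :=
  RawForm.IsSmooth.pastIntegral hΘ.contMDiff hp hα.1 hα.2

lemma isNegOf_negPastIntegral :
    IsNegOf (forwardG Θ)
      (loweringCochain (negPastIntegral hΘ hp (pastIntegral_mem_deRham hΘ hp))) := by
  intro p q h x k hk hk' r v
  obtain ⟨hsmooth, hcompact⟩ := ((deRham N).compact.component x (k + 1) hk').2
  rw [← coe_component, component_loweringCochain _ h x k hk hk']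
  exact congrArg Neg.neg (pastIntegral_apply hΘ.contMDiff hp hsmooth hcompact r v)

lemma isRestriction_negPastIntegral :
    IsRestriction A (loweringCochain (negPastIntegral hΘ hp (pastIntegral_mem_deRham hΘ hp)))
      (loweringCochain (negPastIntegral hΘ hp hA)) := by
  refine Cochain.ext _ _ fun p q h => ?_
  rw [Cochain.comp_zero_cochain_v, Cochain.zero_cochain_comp_v, Cochain.ofHom_v, Cochain.ofHom_v]
  rfl

end NegPastIntegral

end DeRhamSubcomplex

namespace LorentzStructure.IsChiralFlow

variable {N : Type u} [TopologicalSpace N] [ChartedSpace ℝ² N] [IsManifold (𝓡 2) ∞ N]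
  {S : LorentzStructure N} {dir : NullDirection} {Θ : ℝ × N → N}

lemma pastIntegral_mem_dualComplex (h : S.IsChiralFlow dir Θ) (hp : IsProperFlow Θ) (k : ℕ)
    (α : RawForm N (k + 1)) (hα : α ∈ (S.dualComplex dir.sign).compact.carrier (k + 1)) :
    pastIntegral Θ α ∈ (S.dualComplex dir.sign).carrier k := by
  obtain ⟨hΘ, n, -, hpoint, hn⟩ := h
  match k, α, hα with
  | 0, α, hα =>
    exact (Submodule.mem_bot ℝ).2
      (pastIntegral_eq_zero_of_generator hΘ hn ((mem_dualForms_iff hpoint).1 hα.1).2)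
  | 1, α, hα =>
    exact (mem_dualForms_iff hpoint).2
      ⟨RawForm.IsSmooth.pastIntegral hΘ.contMDiff hp hα.1 hα.2,
        pastIntegral_generator hΘ hp hn hα.1 hα.2⟩
  | k + 2, α, hα => exact RawForm.IsSmooth.pastIntegral hΘ.contMDiff hp hα.1 hα.2

lemma exists_isGreensHomotopy_forwardG (h : S.IsChiralFlow dir Θ) (hp : IsProperFlow Θ) :
    ∃ Γ G, IsNegOf (forwardG Θ) Γ ∧ IsRestriction (S.dualComplex dir.sign) Γ G ∧
      IsGreensHomotopy (S.dualComplex dir.sign) (S.J dir) G := by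
  have hmem := h.pastIntegral_mem_dualComplex hp
  exact ⟨_, _, DeRhamSubcomplex.isNegOf_negPastIntegral h.1 hp,
    DeRhamSubcomplex.isRestriction_negPastIntegral h.1 hp hmem,
    DeRhamSubcomplex.isGreensHomotopy_negPastIntegral h.1 hp hmem h.flowFuture_subset_J⟩

lemma exists_isGreensHomotopy_backwardG (h : S.IsChiralFlow dir Θ) (hp : IsProperFlow Θ) :
    ∃ Γ G, IsNegOf (backwardG Θ) Γ ∧ IsRestriction (S.dualComplex dir.sign) Γ G ∧
      IsGreensHomotopy (S.dualComplex dir.sign) (S.J dir.opposite) G := by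
  have hreversed := h.reversed.exists_isGreensHomotopy_forwardG hp.reversed
  rw [dir.sign_opposite] at hreversed
  obtain ⟨Γ, G, hΓ, hG⟩ := hreversed
  refine ⟨Γ, G, fun p q hpq x k hk hk' r v => ?_, hG⟩
  exact (hΓ p q hpq x k hk hk' r v).trans (congrArg Neg.neg (forwardG_reversedFlow h.1 _ r v))

end LorentzStructure.IsChiralFlow

end

theorem mainTheorem10_general {N : Type*} [TopologicalSpace N]
    [ChartedSpace (EuclideanSpace ℝ (Fin 2)) N] [IsManifold (𝓡 2) ∞ N]
    (S : LorentzStructure N) {dir : NullDirection} {Θ : ℝ × N → N}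
    (h : S.IsChiralFlow dir Θ) (hp : IsProperFlow Θ) :
    (∃ Γ G, IsNegOf (forwardG Θ) Γ ∧ IsRestriction (S.dualComplex dir.sign) Γ G ∧
      IsGreensHomotopy (S.dualComplex dir.sign) (S.J dir) G) ∧
    (∃ Γ G, IsNegOf (backwardG Θ) Γ ∧ IsRestriction (S.dualComplex dir.sign) Γ G ∧
      IsGreensHomotopy (S.dualComplex dir.sign) (S.J dir.opposite) G) :=
  ⟨h.exists_isGreensHomotopy_forwardG hp, h.exists_isGreensHomotopy_backwardG hp⟩

theorem mainTheorem10 {N : Type*} [TopologicalSpace N] [T2Space N] [SecondCountableTopology N]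
    [ChartedSpace (EuclideanSpace ℝ (Fin 2)) N] [IsManifold (𝓡 2) ∞ N]
    (S : LorentzStructure N) :
    (∀ Θ : ℝ × N → N, S.IsChiralFlow .ne Θ → IsProperFlow Θ →
      (∃ Γ G, IsNegOf (forwardG Θ) Γ ∧ IsRestriction S.selfDual Γ G ∧
        IsGreensHomotopy S.selfDual (S.J .ne) G) ∧
      (∃ Γ G, IsNegOf (backwardG Θ) Γ ∧ IsRestriction S.selfDual Γ G ∧
        IsGreensHomotopy S.selfDual (S.J .sw) G)) ∧
    (∀ Θ : ℝ × N → N, S.IsChiralFlow .nw Θ → IsProperFlow Θ →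
      (∃ Γ G, IsNegOf (forwardG Θ) Γ ∧ IsRestriction S.antiSelfDual Γ G ∧
        IsGreensHomotopy S.antiSelfDual (S.J .nw) G) ∧
      (∃ Γ G, IsNegOf (backwardG Θ) Γ ∧ IsRestriction S.antiSelfDual Γ G ∧
        IsGreensHomotopy S.antiSelfDual (S.J .se) G)) :=
  ⟨fun _ h hp => (mainTheorem10_general S h hp).imp id id,
    fun _ h hp => (mainTheorem10_general S h hp).imp id id⟩
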